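/- Let $h_1\ge 0$ be an integer, let $r'_j\ge 1$ ($j\ge 1$) be integers with $r'_j\to\infty$, and put $r_j=2r'_j$ and $$(s_j(1),\dots,s_j(r_j))=(0,1,\dots,r'_j-1,\,0,1,\dots,r'_j-1),\qquad h_{j+1}+1=(h_j+1)r_j+\sum_{i=1}^{r_j}s_j(i).$$ Assume $r_j^2/h_j\to 0$. Let $T$ be the double staircase transformation defined by these data, that is, an invertible measure-preserving transformation of a probability space $(X,\mu)$ for which there are measurable sets $E_j$ ($j\ge1$) such that the levels $E_j,TE_j,\dots,T^{h_j}E_j$ are pairwise disjoint, $E_j$ is a disjoint union of $r_j$ measurable sets $E_j^1,\dots,E_j^{r_j}$ of equal measure, $T^{h_j+s_j(i)+1}E_j^i=E_j^{i+1}$ for $1\le i<r_j$, $E_{j+1}=E_j^1$, and every measurable set is approximated arbitrarily well in measure by unions of levels $T^kE_j$, $0\le k\le h_j$, with a common $j$. Let $\Theta$ be the orthogonal projection of $L_2(X,\mu)$ onto the constant functions, and let $T^n$ also denote the operator $f\mapsto f\circ T^n$ on $L_2(X,\mu)$. Put $$M=\mathbb N\setminus\bigcup_{j\ge1}\Bigl[\tfrac{h_{j+1}}2-h_j,\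 \tfrac{h_{j+1}}2+h_j\Bigr].$$ Then $M$ is a mixing set: if $m_i\in M$ and $m_i\to\infty$, then $T^{m_i}\to\Theta$ in the weak operator topology. Consequently, let $n_i$ be integers with $|n_i|\to\infty$, and let (P) denote the property of an index $i$ that, for some $j\ge1$, $$|n_i|\in[h_j,h_{j+1})\quad\text{and}\quad |n_i|\in\Bigl[\tfrac{h_{j+1}}2-h_j,\ \tfrac{h_{j+1}}2+h_j\Bigr].$$ If no subsequence of $T^{n_i}$ converges weakly to $\Theta$, then all but finitely many $i$ have property (P). If $T^{n_i}$ does not converge weakly to $\Theta$, then infinitely many $i$ have property (P). -/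

import Mathlib

open Filter MeasureTheory
open scoped Topology

noncomputable section

/-- The number `h j`: the tower of step `j` has the `h j + 1` levels `E j, T (E j), …, T ^ (h j) (E j)`.
The first tower has top index `h₁`. At step `j` every tower is cut into `r j` columns, and `s j i`
spacers are put over the `i`-th column, `0 ≤ i < r j`. (Steps and columns are numbered from `0`.) -/
def towerHeight (h₁ : ℕ) (r : ℕ → ℕ) (s : ℕ → ℕ → ℕ) : ℕ → ℕ
  | 0 => h₁
  | j + 1 => (towerHeight h₁ r s j + 1) * r j + ∑ i ∈ Finset.range (r j), s j i - 1

/-- The subtraction in the definition of `towerHeight` is not truncated. -/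
theorem towerHeight_succ_add_one (h₁ : ℕ) (r : ℕ → ℕ) (s : ℕ → ℕ → ℕ) (j : ℕ) (hr : 0 < r j) :
    towerHeight h₁ r s (j + 1) + 1
      = (towerHeight h₁ r s j + 1) * r j + ∑ i ∈ Finset.range (r j), s j i := by
  have h : 0 < (towerHeight h₁ r s j + 1) * r j := Nat.mul_pos (Nat.succ_pos _) hr
  rw [towerHeight]
  omega

/-- `T` is a rank one transformation of `(X, μ)`, constructed by cutting and stacking from the
initial height `h₁`, the numbers of cuts `r j` and the spacers `s j i`. Here `E j` is the base of the
tower of step `j` and `C j i`, `i < r j`, are the pieces into which `E j` is cut. -/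
structure IsRankOneTower {X : Type*} [MeasurableSpace X] (μ : Measure X) (T : X ≃ᵐ X)
    (h₁ : ℕ) (r : ℕ → ℕ) (s : ℕ → ℕ → ℕ) (E : ℕ → Set X) (C : ℕ → ℕ → Set X) : Prop where
  measurableSet_base : ∀ j, MeasurableSet (E j)
  measurableSet_piece : ∀ j, ∀ i < r j, MeasurableSet (C j i)
  /-- The levels of a tower are pairwise disjoint. -/
  disjoint_levels : ∀ j, ∀ k ≤ towerHeight h₁ r s j, ∀ l ≤ towerHeight h₁ r s j, k ≠ l →
    Disjoint (T^[k] '' E j) (T^[l] '' E j)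
  /-- The base is cut into `r j` disjoint pieces of equal measure. -/
  base_eq : ∀ j, E j = ⋃ i < r j, C j i
  disjoint_pieces : ∀ j, ∀ i < r j, ∀ i' < r j, i ≠ i' → Disjoint (C j i) (C j i')
  measure_piece : ∀ j, ∀ i < r j, ∀ i' < r j, μ (C j i) = μ (C j i')
  /-- Above the top level of the `i`-th column and its `s j i` spacers comes the next column. -/
  next_column : ∀ j i, i + 1 < r j →
    T^[towerHeight h₁ r s j + s j i + 1] '' C j i = C j (i + 1)
  /-- The base of the next tower is the first piece. -/
  base_succ : ∀ j, E (j + 1) = C j 0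
  /-- Every measurable set is approximated in measure by unions of levels of towers. -/
  generating : ∀ A : Set X, MeasurableSet A → ∀ ε : ENNReal, 0 < ε →
    ∃ j, ∃ S : Set ℕ, (∀ k ∈ S, k ≤ towerHeight h₁ r s j) ∧
      μ (symmDiff A (⋃ k ∈ S, T^[k] '' E j)) < ε

/-- The spacers `0, 1, …, r' j - 1, 0, 1, …, r' j - 1` of the double staircase
over the columns `i = 0, …, 2 * r' j - 1`. -/
def doubleStair (r' : ℕ → ℕ) (j i : ℕ) : ℕ := if i < r' j then i else i - r' j

/-- The top index `h j` of the `j`-th tower of the double staircase with `2 * r' j` columns. -/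
def dsHeight (h₁ : ℕ) (r' : ℕ → ℕ) : ℕ → ℕ :=
  towerHeight h₁ (fun j => 2 * r' j) (doubleStair r')

/-- `T` is the double staircase transformation with initial height `h₁` and with
`r j = 2 * r' j` columns at step `j`. -/
def IsDoubleStaircase {X : Type*} [MeasurableSpace X] (μ : Measure X) (T : X ≃ᵐ X)
    (h₁ : ℕ) (r' : ℕ → ℕ) : Prop :=
  ∃ (E : ℕ → Set X) (C : ℕ → ℕ → Set X),
    IsRankOneTower μ T h₁ (fun j => 2 * r' j) (doubleStair r') E C

/-- The interval `[h (j + 1) / 2 - h j, h (j + 1) / 2 + h j]` of real numbers. -/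
def halfInterval (h₁ : ℕ) (r' : ℕ → ℕ) (j : ℕ) : Set ℝ :=
  Set.Icc ((dsHeight h₁ r' (j + 1) : ℝ) / 2 - dsHeight h₁ r' j)
    ((dsHeight h₁ r' (j + 1) : ℝ) / 2 + dsHeight h₁ r' j)

/-- The set `M` of all natural numbers that are in none of the intervals. -/
def mixingTimes (h₁ : ℕ) (r' : ℕ → ℕ) : Set ℕ :=
  {m | (m : ℝ) ∉ ⋃ j, halfInterval h₁ r' j}

section Koopman

variable {X : Type*} [MeasurableSpace X] {μ : Measure X}

/-- The unitary operator `f ↦ f ∘ T` on `L²(X, μ)`. Its group powers, with natural or integer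
exponents, are the operators that the powers of `T` induce. -/
def koopman (𝕜 : Type*) [RCLike 𝕜] (T : X ≃ᵐ X) (hT : MeasurePreserving T μ μ) :
    Lp 𝕜 2 μ ≃ₗᵢ[𝕜] Lp 𝕜 2 μ where
  toFun := Lp.compMeasurePreservingₗᵢ 𝕜 T hT
  invFun := Lp.compMeasurePreservingₗᵢ 𝕜 T.symm (hT.symm T)
  map_add' := map_add _
  map_smul' := map_smul _
  norm_map' := LinearIsometry.norm_map _
  left_inv f := by
    apply Lp.ext
    have h1 := Lp.coeFn_compMeasurePreserving
      (Lp.compMeasurePreserving (p := 2) T hT f) (hT.symm T)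
    have h2 := (hT.symm T).quasiMeasurePreserving.ae_eq_comp
      (Lp.coeFn_compMeasurePreserving (p := 2) f hT)
    refine h1.trans (h2.trans (Eventually.of_forall fun x => ?_))
    simp
  right_inv f := by
    apply Lp.ext
    have h1 := Lp.coeFn_compMeasurePreserving
      (Lp.compMeasurePreserving (p := 2) T.symm (hT.symm T) f) hT
    have h2 := hT.quasiMeasurePreserving.ae_eq_comp
      (Lp.coeFn_compMeasurePreserving (p := 2) f (hT.symm T))
    refine h1.trans (h2.trans (Eventually.of_forall fun x => ?_))
    simp

/-- The orthogonal projection of `L²(X, μ)` onto the space of constant functions. -/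
def constProjection (𝕜 : Type*) [RCLike 𝕜] (μ : Measure X) [IsFiniteMeasure μ] :
    Lp 𝕜 2 μ →L[𝕜] Lp 𝕜 2 μ :=
  (Submodule.span 𝕜 {Lp.const 2 μ (1 : 𝕜)}).starProjection

/-- `T ^ (n i) → Θ` in the weak operator topology of `L²(X, μ)`, where `n` is a sequence of
integers and `Θ` is the orthogonal projection onto the constants. -/
def IsMixingAlong (𝕜 : Type*) [RCLike 𝕜] [IsFiniteMeasure μ] (T : X ≃ᵐ X)
    (hT : MeasurePreserving T μ μ) (n : ℕ → ℤ) : Prop :=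
  ∀ f g : Lp 𝕜 2 μ,
    Tendsto (fun i => inner 𝕜 g ((koopman 𝕜 T hT ^ n i) f)) atTop
      (𝓝 (inner 𝕜 g (constProjection 𝕜 μ f)))

end Koopman

end

/-!
The key to mixing is that the spacers turn a shift by a whole number of columns into an average.
Write `H` and `K` for the numbers of levels of two consecutive towers, `ρ = r' j`, and let
`H ≤ m = a * H + b < K`. Inside the higher tower, `T ^ m` moves the level `ℓ` of column `i` of the
lower tower to column `i + c`, where `c = a` if `ℓ + b < H` and `c = a + 1` otherwise, and the
spacers in between lower the level by an amount that is affine in `i` as long as `i` and `i + c`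
each stay in one half of the double staircase. Its slope is `c` if both columns lie in the same half
and `c - ρ` if they lie in different halves. Hence the correlation of `f ∘ T ^ m` and `g`, for
functions that are constant on the levels, is controlled by the sums
`∑ f ∘ T ^ (σ i)` with the slopes `σ = c` and `σ = |c - ρ|`; the part of the higher tower that
`T ^ m` moves out of its top is treated in the same way one step later, with slope `1`. This is
`IsRankOneTower.abs_integral_le`. The only slope without cancellation is `σ = 0`, that is `c = ρ`,
and it occurs just when `m` is within `H` of half of `K`: these times are removed from the set
`mixingTimes`.

It remains to bound the norms of the power sums, `∑ f ∘ T ^ (σ i)` over `i < L`, by `ε * ρ`,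
uniformly in `1 ≤ σ ≤ ρ` and `L ≤ ρ`.
* `T` is ergodic (`IsRankOneTower.ergodic`), so slope `1` is harmless. This gives mixing along
  times `H + b` with bounded `b`, and therefore every power of `T` is ergodic
  (`IsRankOneTower.ergodic_iterate`). By the mean ergodic theorem every fixed slope is harmless, and
  this gives mixing along times between `H` and a bounded multiple of `H`
  (`IsRankOneTower.eventually_abs_integral_le_of_sublinear`).
* For large `σ` choose a step `t` with `σ` between the heights `H` and `K` of steps `t` and `t + 1`,
  and a multiple `k * σ` between `K` and `2 * K`. The bounded multiples of `k * σ` are mixing times,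
  so averages over `N` powers of `T ^ (k * σ)` are small; since `k` is of the order of `r' t`, which
  is much smaller than `H ≤ σ ≤ ρ`, they dominate the sum in question. This argument of Adams is
  `IsRankOneTower.exists_powerSumNorm_le`.

Functions constant on levels are dense, which carries mixing over to measurable sets and then to
`L²`; negative times are the adjoints of positive ones.
-/

/-! ### Words over the columns of a double staircase -/

/-- The position at which column `n` starts in the next tower, for a tower with `H` levels that is
cut into the columns of a double staircase with `2 * ρ` columns. At `n = 2 * ρ` this is the number
of levels of the next tower. -/
def columnStart (ρ H n : ℕ) : ℕ :=
  n * H + ∑ i ∈ Finset.range n, (if i < ρ then i else i - ρ)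

/-- The total number of spacers over the first `n` columns of a double staircase. -/
def stairSum (ρ n : ℕ) : ℕ := ∑ i ∈ Finset.range n, (if i < ρ then i else i - ρ)

theorem columnStart_eq (ρ H n : ℕ) : columnStart ρ H n = n * H + stairSum ρ n := rfl

theorem columnStart_zero (ρ H : ℕ) : columnStart ρ H 0 = 0 := by simp [columnStart]

theorem columnStart_succ (ρ H n : ℕ) :
    columnStart ρ H (n + 1) = columnStart ρ H n + H + (if n < ρ then n else n - ρ) := by
  rw [columnStart, columnStart, Finset.sum_range_succ]
  ring

theorem stairSum_succ (ρ n : ℕ) :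
    stairSum ρ (n + 1) = stairSum ρ n + (if n < ρ then n else n - ρ) :=
  Finset.sum_range_succ _ _

theorem stairSum_mono (ρ : ℕ) : Monotone (stairSum ρ) :=
  monotone_nat_of_le_succ fun n => by rw [stairSum_succ]; exact Nat.le_add_right _ _

/-- Inside a half of the staircase, the number of spacers met on the way from column `i` to column
`i + c` is affine in `i` with slope `c`. -/
theorem stairSum_add (ρ i c : ℕ) (h : i + c ≤ ρ) :
    stairSum ρ (i + c) = stairSum ρ i + stairSum ρ c + c * i := by
  induction c with
  | zero => simp [stairSum]
  | succ c ih =>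
    rw [← add_assoc, stairSum_succ, ih (by omega), stairSum_succ, if_pos (by omega),
      if_pos (by omega)]
    ring

theorem stairSum_add_half (ρ n : ℕ) (h : n ≤ ρ) :
    stairSum ρ (ρ + n) = stairSum ρ ρ + stairSum ρ n := by
  induction n with
  | zero => simp [stairSum]
  | succ n ih =>
    rw [← add_assoc, stairSum_succ, ih (by omega), stairSum_succ, if_neg (by omega),
      if_pos (by omega)]
    omega

theorem two_mul_stairSum_add (ρ n : ℕ) (h : n ≤ ρ) : 2 * stairSum ρ n + n = n * n := by
  induction n with
  | zero => simp [stairSum]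
  | succ n ih =>
    have := ih (by omega)
    rw [stairSum_succ, if_pos (by omega)]
    linarith

theorem stairSum_two_mul_add (ρ : ℕ) : stairSum ρ (2 * ρ) + ρ = ρ * ρ := by
  have h1 := stairSum_add_half ρ ρ le_rfl
  have h2 := two_mul_stairSum_add ρ ρ le_rfl
  rw [two_mul]
  omega

theorem stairSum_le (ρ n : ℕ) (h : n ≤ 2 * ρ) : stairSum ρ n ≤ ρ * ρ := by
  have h1 := stairSum_mono ρ h
  have h2 := stairSum_two_mul_add ρ
  omega

theorem abs_sum_le_card {s : Finset ℕ} {P : ℕ → ℝ} (hP : ∀ y, |P y| ≤ 1) :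
    |∑ y ∈ s, P y| ≤ s.card :=
  (Finset.abs_sum_le_sum_abs _ _).trans
    ((Finset.sum_le_card_nsmul _ _ 1 fun y _ => hP y).trans (by simp))

theorem abs_sum_sub_sum_columns_le (ρ H n : ℕ) {P : ℕ → ℝ} (hP : ∀ y, |P y| ≤ 1) :
    |∑ z ∈ Finset.range (columnStart ρ H n), P z
        - ∑ i ∈ Finset.range n, ∑ y ∈ Finset.range H, P (columnStart ρ H i + y)|
      ≤ stairSum ρ n := by
  induction n with
  | zero => simp [columnStart]
  | succ n ih =>
    rw [columnStart_succ, Finset.sum_range_add, Finset.sum_range_add, Finset.sum_range_succ,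
      stairSum_succ]
    have h2 := abs_sum_le_card (s := Finset.range (if n < ρ then n else n - ρ))
      (P := fun t => P (columnStart ρ H n + H + t)) (fun y => hP _)
    rw [Finset.card_range] at h2
    push_cast
    rw [abs_le] at *
    push_cast at h2
    constructor <;> linarith [h2.1, h2.2]

/-- The sum of `|∑ i < L, Φ (u + σ * i)|` over all arithmetic progressions of length `L` and
difference `σ` that lie in `[0, H)`. -/
def progressionSum (Φ : ℕ → ℝ) (H σ L : ℕ) : ℝ :=
  ∑ u ∈ (Finset.range H).filter (fun u => u + σ * (L - 1) < H),
    |∑ i ∈ Finset.range L, Φ (u + σ * i)|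

theorem progressionSum_nonneg (Φ : ℕ → ℝ) (H σ L : ℕ) : 0 ≤ progressionSum Φ H σ L :=
  Finset.sum_nonneg fun _ _ => abs_nonneg _

theorem progressionSum_one_le {Φ : ℕ → ℝ} (hΦ : ∀ y, |Φ y| ≤ 1) (H σ : ℕ) :
    progressionSum Φ H σ 1 ≤ H := by
  have : progressionSum Φ H σ 1 = ∑ u ∈ Finset.range H, |Φ u| := by
    simp [progressionSum, Finset.filter_true_of_mem]
  rw [this]
  exact (Finset.sum_le_card_nsmul _ _ 1 fun y _ => hΦ y).trans (by simp)

/-- The letters over a rectangle of columns and levels are grouped by level: when the target levels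
`ℓ + b - θ i` run through an arithmetic progression as the column `i` varies, ascending or
descending, each group is a sum along a progression of difference `σ`, and distinct levels give
distinct progressions. -/
theorem abs_sum_rectangle_le {Φ γ : ℕ → ℝ} (hγ : ∀ y, |γ y| ≤ 1) (H σ L b : ℕ) (Λ : Finset ℕ)
    (θ : ℕ → ℕ) (hθ : ∀ i < L, ∀ ℓ ∈ Λ, θ i ≤ ℓ + b ∧ ℓ + b < θ i + H)
    (hlin : (∀ i < L, θ i = θ 0 + σ * i) ∨ (∀ i < L, θ i + σ * i = θ 0)) :
    |∑ i ∈ Finset.range L, ∑ ℓ ∈ Λ, Φ (ℓ + b - θ i) * γ ℓ| ≤ progressionSum Φ H σ L := by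
  rcases Nat.eq_zero_or_pos L with rfl | hL
  · simpa using progressionSum_nonneg Φ H σ 0
  rw [Finset.sum_comm]
  have key : ∀ u : ℕ → ℕ, Set.InjOn u Λ → (∀ ℓ ∈ Λ, u ℓ + σ * (L - 1) < H) →
      (∀ ℓ ∈ Λ, ∑ i ∈ Finset.range L, Φ (ℓ + b - θ i)
        = ∑ i ∈ Finset.range L, Φ (u ℓ + σ * i)) →
      |∑ ℓ ∈ Λ, ∑ i ∈ Finset.range L, Φ (ℓ + b - θ i) * γ ℓ| ≤ progressionSum Φ H σ L := by
    intro u hinj hu hsum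
    calc |∑ ℓ ∈ Λ, ∑ i ∈ Finset.range L, Φ (ℓ + b - θ i) * γ ℓ|
        ≤ ∑ ℓ ∈ Λ, |∑ i ∈ Finset.range L, Φ (ℓ + b - θ i) * γ ℓ| :=
          Finset.abs_sum_le_sum_abs _ _
      _ ≤ ∑ ℓ ∈ Λ, |∑ i ∈ Finset.range L, Φ (u ℓ + σ * i)| := by
          refine Finset.sum_le_sum fun ℓ hℓ => ?_
          rw [← Finset.sum_mul, hsum ℓ hℓ, abs_mul]
          exact mul_le_of_le_one_right (abs_nonneg _) (hγ ℓ)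
      _ = ∑ v ∈ Λ.image u, |∑ i ∈ Finset.range L, Φ (v + σ * i)| :=
          (Finset.sum_image (f := fun v => |∑ i ∈ Finset.range L, Φ (v + σ * i)|)
            fun x hx y hy h => hinj hx hy h).symm
      _ ≤ progressionSum Φ H σ L := by
          refine Finset.sum_le_sum_of_subset_of_nonneg ?_ fun _ _ _ => abs_nonneg _
          intro v hv
          obtain ⟨ℓ, hℓ, rfl⟩ := Finset.mem_image.1 hv
          have := hu ℓ hℓ
          simp only [Finset.mem_filter, Finset.mem_range]
          exact ⟨by omega, this⟩
  rcases hlin with h | h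
  · -- descending progressions are read from their last term upwards
    refine key (fun ℓ => ℓ + b - θ (L - 1)) ?_ ?_ ?_
    · intro x hx y hy hxy
      have h1 := hθ (L - 1) (by omega) x hx
      have h2 := hθ (L - 1) (by omega) y hy
      simp only at hxy
      omega
    · intro ℓ hℓ
      have h1 := hθ (L - 1) (by omega) ℓ hℓ
      have h2 := hθ 0 hL ℓ hℓ
      have h3 := h (L - 1) (by omega)
      omega
    · intro ℓ hℓ
      rw [← Finset.sum_range_reflect]
      refine Finset.sum_congr rfl fun i hi => ?_
      rw [Finset.mem_range] at hi
      congr 1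
      have h1 := hθ (L - 1) (by omega) ℓ hℓ
      have h3 := h (L - 1) (by omega)
      have h4 := h (L - 1 - i) (by omega)
      have h5 : σ * (L - 1) = σ * (L - 1 - i) + σ * i := by rw [← mul_add]; congr 1; omega
      omega
  · refine key (fun ℓ => ℓ + b - θ 0) ?_ ?_ ?_
    · intro x hx y hy hxy
      have h1 := hθ 0 hL x hx
      have h2 := hθ 0 hL y hy
      simp only at hxy
      omega
    · intro ℓ hℓ
      have h1 := hθ (L - 1) (by omega) ℓ hℓ
      have h2 := hθ 0 hL ℓ hℓ
      have h3 := h (L - 1) (by omega)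
      omega
    · intro ℓ hℓ
      refine Finset.sum_congr rfl fun i hi => ?_
      rw [Finset.mem_range] at hi
      congr 1
      have h1 := hθ 0 hL ℓ hℓ
      have h2 := hθ i hi ℓ hℓ
      have h4 := h i hi
      omega

/-- The word `Φ` repeats its first `H` letters in each of the `2 * ρ` columns. -/
def IsColumnPeriodic (ρ H : ℕ) (Φ : ℕ → ℝ) : Prop :=
  ∀ i < 2 * ρ, ∀ ℓ < H, Φ (columnStart ρ H i + ℓ) = Φ ℓ

/-- The correlation of two words over a block of `L` consecutive columns, when the shift by `m`
moves each of them by `c` columns and the number `S i` of spacers passed is affine in the column.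
Here `κ = 0` for levels that stay below the top of their column and `κ = H` for those that pass
it. -/
theorem abs_sum_block_le {ρ H : ℕ} {Φ Γ : ℕ → ℝ} (hΦ : IsColumnPeriodic ρ H Φ)
    (hΓ : IsColumnPeriodic ρ H Γ) (hΓ1 : ∀ y, |Γ y| ≤ 1) {m b c κ : ℕ} (hm : m + κ = c * H + b)
    {Λ : Finset ℕ} (hΛ : ∀ ℓ ∈ Λ, ℓ < H ∧ κ + ρ * ρ ≤ ℓ + b ∧ ℓ + b < κ + H)
    {i₀ L σ : ℕ} (hL : i₀ + L + c ≤ 2 * ρ) (S : ℕ → ℕ)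
    (hS : ∀ i < L, stairSum ρ (i₀ + i + c) = stairSum ρ (i₀ + i) + S i)
    (hlin : (∀ i < L, S i = S 0 + σ * i) ∨ (∀ i < L, S i + σ * i = S 0)) :
    |∑ i ∈ Finset.range L, ∑ ℓ ∈ Λ, Φ (columnStart ρ H (i₀ + i) + ℓ + m)
        * Γ (columnStart ρ H (i₀ + i) + ℓ)| ≤ progressionSum Φ H σ L := by
  have hSle : ∀ i < L, S i ≤ ρ * ρ := fun i hi => by
    have h1 := hS i hi
    have h2 := stairSum_le ρ (i₀ + i + c) (by omega)
    omega
  have := abs_sum_rectangle_le (Φ := Φ) hΓ1 H σ L b Λ (fun i => κ + S i) ?_ ?_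
  · convert this using 2
    refine Finset.sum_congr rfl fun i hi => Finset.sum_congr rfl fun ℓ hℓ => ?_
    rw [Finset.mem_range] at hi
    have h1 := hΛ ℓ hℓ
    have h2 := hSle i hi
    rw [hΓ (i₀ + i) (by omega) ℓ h1.1]
    congr 1
    rw [← hΦ (i₀ + i + c) (by omega) (ℓ + b - (κ + S i)) (by omega)]
    congr 1
    rw [columnStart_eq, columnStart_eq, hS i hi, add_mul (i₀ + i) c H]
    omega
  · intro i hi ℓ hℓ
    have h1 := hΛ ℓ hℓ
    have h2 := hSle i hi
    omega
  · rcases hlin with h | h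
    · left; intro i hi; have := h i hi; omega
    · right; intro i hi; have := h i hi; omega

/-- The bound for the correlation under a shift by `c` columns: two blocks in which the column and
its target lie in the same half of the staircase, with slope `c`, and one block that crosses from
the first half to the second, with slope `|c - ρ|`. In truncated subtraction this slope is
`(c - ρ) + (ρ - c)`, and blocks that do not exist have length `0`. -/
def shiftSum (Φ : ℕ → ℝ) (H ρ c : ℕ) : ℝ :=
  2 * progressionSum Φ H c (ρ - c)
    + progressionSum Φ H ((c - ρ) + (ρ - c)) (min c (2 * ρ - c))

theorem abs_sum_columns_le {ρ H : ℕ} {Φ Γ : ℕ → ℝ} (hΦ : IsColumnPeriodic ρ H Φ)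
    (hΓ : IsColumnPeriodic ρ H Γ) (hΓ1 : ∀ y, |Γ y| ≤ 1) {m b c κ : ℕ} (hm : m + κ = c * H + b)
    {Λ : Finset ℕ} (hΛ : ∀ ℓ ∈ Λ, ℓ < H ∧ κ + ρ * ρ ≤ ℓ + b ∧ ℓ + b < κ + H) :
    |∑ i ∈ Finset.range (2 * ρ - c), ∑ ℓ ∈ Λ, Φ (columnStart ρ H i + ℓ + m)
        * Γ (columnStart ρ H i + ℓ)| ≤ shiftSum Φ H ρ c := by
  rw [shiftSum]
  rcases le_total c ρ with hc | hc
  · have e1 : 2 * ρ - c = (ρ - c) + c + (ρ - c) := by omega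
    have e2 : min c (2 * ρ - c) = c := by omega
    have e3 : (c - ρ) + (ρ - c) = ρ - c := by omega
    rw [e2, e3, e1, Finset.sum_range_add, Finset.sum_range_add]
    have e4 : ρ - c + c = ρ := by omega
    rw [e4]
    have b1 := abs_sum_block_le hΦ hΓ hΓ1 hm hΛ (i₀ := 0) (L := ρ - c) (σ := c) (by omega)
      (fun i => stairSum ρ c + c * i)
      (fun i hi => by rw [zero_add, stairSum_add _ _ _ (by omega)]; ring)
      (Or.inl fun i _ => by simp)
    have b2 := abs_sum_block_le hΦ hΓ hΓ1 hm hΛ (i₀ := ρ - c) (L := c) (σ := ρ - c) (by omega)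
      (fun i => stairSum ρ ρ - stairSum ρ (ρ - c) - (ρ - c) * i)
      (fun i hi => by
        have h1 := stairSum_add_half ρ i (by omega)
        have h2 := stairSum_add ρ i (ρ - c) (by omega)
        have h3 := stairSum_mono ρ (show i + (ρ - c) ≤ ρ by omega)
        have e5 : ρ - c + i + c = ρ + i := by omega
        have e6 : ρ - c + i = i + (ρ - c) := by omega
        rw [e5, e6, h1]
        omega)
      (Or.inr fun i hi => by
        have h2 := stairSum_add ρ i (ρ - c) (by omega)
        have h3 := stairSum_mono ρ (show i + (ρ - c) ≤ ρ by omega)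
        simp only [mul_zero]
        omega)
    have b3 := abs_sum_block_le hΦ hΓ hΓ1 hm hΛ (i₀ := ρ) (L := ρ - c) (σ := c) (by omega)
      (fun i => stairSum ρ c + c * i)
      (fun i hi => by
        rw [add_assoc, stairSum_add_half _ _ (by omega), stairSum_add_half _ _ (by omega),
          stairSum_add _ _ _ (by omega)]
        ring)
      (Or.inl fun i _ => by simp)
    simp only [zero_add] at b1
    refine (abs_add_le _ _).trans ?_
    refine (add_le_add ((abs_add_le _ _).trans (add_le_add b1 b2)) b3).trans (le_of_eq ?_)
    ring
  · have e1 : min c (2 * ρ - c) = 2 * ρ - c := by omega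
    have e2 : (c - ρ) + (ρ - c) = c - ρ := by omega
    rw [e1, e2]
    rcases lt_or_ge (2 * ρ) c with hc2 | hc2
    · rw [Nat.sub_eq_zero_of_le hc2.le]
      simpa using add_nonneg (mul_nonneg zero_le_two (progressionSum_nonneg Φ H c (ρ - c)))
        (progressionSum_nonneg Φ H (c - ρ) 0)
    have b := abs_sum_block_le hΦ hΓ hΓ1 hm hΛ (i₀ := 0) (L := 2 * ρ - c) (σ := c - ρ)
      (by omega)
      (fun i => stairSum ρ ρ + stairSum ρ (c - ρ) + (c - ρ) * i)
      (fun i hi => by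
        have e : 0 + i + c = ρ + (i + (c - ρ)) := by omega
        rw [e, stairSum_add_half _ _ (by omega), stairSum_add _ _ _ (by omega), zero_add]
        ring)
      (Or.inl fun i _ => by simp)
    simp only [zero_add] at b
    linarith [progressionSum_nonneg Φ H c (ρ - c)]

/-! ### Correlations of words -/

theorem abs_mul_le_one {x y : ℝ} (hx : |x| ≤ 1) (hy : |y| ≤ 1) : |x * y| ≤ 1 := by
  rw [abs_mul]; exact mul_le_one₀ hx (abs_nonneg _) hy

theorem card_filter_add_le (H b κ e : ℕ) :
    ((Finset.range H).filter fun ℓ => κ ≤ ℓ + b ∧ ℓ + b < κ + e).card ≤ e := by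
  refine (Finset.card_le_card (t := Finset.Ico (κ - b) (κ - b + e)) ?_).trans (by simp)
  intro ℓ hℓ
  simp only [Finset.mem_filter, Finset.mem_range, Finset.mem_Ico] at hℓ ⊢
  omega

/-- For the levels in `Λ`, the shift by `m` leaves the tower exactly from the last `c` columns. -/
theorem sum_columns_truncated {ρ H : ℕ} {Φ Γ : ℕ → ℝ} {m b c κ : ℕ} (hm : m + κ = c * H + b)
    {Λ : Finset ℕ} (hΛ : ∀ ℓ ∈ Λ, ℓ < H ∧ κ + ρ * ρ ≤ ℓ + b ∧ ℓ + b < κ + H) :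
    ∑ i ∈ Finset.range (2 * ρ), ∑ ℓ ∈ Λ,
        (if columnStart ρ H i + ℓ + m < columnStart ρ H (2 * ρ)
          then Φ (columnStart ρ H i + ℓ + m) * Γ (columnStart ρ H i + ℓ) else 0)
      = ∑ i ∈ Finset.range (2 * ρ - c), ∑ ℓ ∈ Λ,
        Φ (columnStart ρ H i + ℓ + m) * Γ (columnStart ρ H i + ℓ) := by
  rw [← Finset.sum_subset (s₁ := Finset.range (2 * ρ - c))]
  · refine Finset.sum_congr rfl fun i hi => Finset.sum_congr rfl fun ℓ hℓ => if_pos ?_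
    rw [Finset.mem_range] at hi
    have h1 := hΛ ℓ hℓ
    have h2 : (i + c + 1) * H ≤ 2 * ρ * H := Nat.mul_le_mul_right _ (by omega)
    have h3 := stairSum_mono ρ (show i ≤ 2 * ρ by omega)
    have h4 : (i + c + 1) * H = i * H + c * H + H := by ring
    rw [columnStart_eq, columnStart_eq]
    omega
  · exact Finset.range_mono (Nat.sub_le _ _)
  · intro i hi hi'
    refine Finset.sum_eq_zero fun ℓ hℓ => if_neg ?_
    rw [Finset.mem_range] at hi hi'
    have h1 := hΛ ℓ hℓ
    have h2 : 2 * ρ * H ≤ (i + c) * H := Nat.mul_le_mul_right _ (by omega)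
    have h3 := stairSum_le ρ (2 * ρ) le_rfl
    have h4 : (i + c) * H = i * H + c * H := by ring
    rw [columnStart_eq, columnStart_eq]
    omega

theorem abs_sum_sum_le {n : ℕ} {s : Finset ℕ} {P : ℕ → ℕ → ℝ} (hP : ∀ i y, |P i y| ≤ 1) {k : ℕ}
    (hs : s.card ≤ k) : |∑ i ∈ Finset.range n, ∑ y ∈ s, P i y| ≤ n * k := by
  refine (Finset.abs_sum_le_sum_abs _ _).trans
    ((Finset.sum_le_card_nsmul _ _ (k : ℝ) fun i _ => ?_).trans (by simp))
  exact (abs_sum_le_card (hP i)).trans (by exact_mod_cast hs)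

/-- The part of the correlation that stays inside the next tower. Apart from the spacers and at most
`2 * ρ ^ 2` levels of each column, every level moves by `a` or by `a + 1` columns, the latter only
if `b > ρ ^ 2`. -/
theorem abs_inner_sum_le {ρ H : ℕ} {Φ Γ : ℕ → ℝ} (hΦ : IsColumnPeriodic ρ H Φ)
    (hΓ : IsColumnPeriodic ρ H Γ) (hΦ1 : ∀ y, |Φ y| ≤ 1) (hΓ1 : ∀ y, |Γ y| ≤ 1) {m a b : ℕ}
    (hm : m = a * H + b) (hb : b < H) :
    |∑ y ∈ Finset.range (columnStart ρ H (2 * ρ)),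
        (if y + m < columnStart ρ H (2 * ρ) then Φ (y + m) * Γ y else 0)|
      ≤ shiftSum Φ H ρ a + (if b ≤ ρ * ρ then 0 else shiftSum Φ H ρ (a + 1))
        + (ρ * ρ : ℝ) * (4 * ρ + 1) := by
  set K := columnStart ρ H (2 * ρ) with hK
  set P : ℕ → ℝ := fun y => if y + m < K then Φ (y + m) * Γ y else 0 with hP
  have hP1 : ∀ y, |P y| ≤ 1 := fun y => by
    simp only [hP]
    split_ifs
    · exact abs_mul_le_one (hΦ1 _) (hΓ1 _)
    · simp
  have h0 := abs_sum_sub_sum_columns_le ρ H (2 * ρ) hP1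
  have hsplit : ∀ i, ∑ y ∈ Finset.range H, P (columnStart ρ H i + y)
      = ∑ y ∈ (Finset.range H).filter (fun ℓ => ρ * ρ ≤ ℓ + b ∧ ℓ + b < H),
          P (columnStart ρ H i + y)
        + ∑ y ∈ (Finset.range H).filter (fun ℓ => H + ρ * ρ ≤ ℓ + b), P (columnStart ρ H i + y)
        + ∑ y ∈ (Finset.range H).filter
            (fun ℓ => ¬ (ρ * ρ ≤ ℓ + b ∧ ℓ + b < H) ∧ ¬ (H + ρ * ρ ≤ ℓ + b)),
            P (columnStart ρ H i + y) := by
    intro i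
    rw [Finset.sum_filter, Finset.sum_filter, Finset.sum_filter, ← Finset.sum_add_distrib,
      ← Finset.sum_add_distrib]
    refine Finset.sum_congr rfl fun y _ => ?_
    by_cases h1 : ρ * ρ ≤ y + b ∧ y + b < H
    · have h2 : ¬ (H + ρ * ρ ≤ y + b) := by omega
      simp [h1, h2]
    · by_cases h2 : H + ρ * ρ ≤ y + b
      · simp [h1, h2]
      · simp [h1, h2]
  have hlow := abs_sum_columns_le hΦ hΓ hΓ1 (c := a) (κ := 0) (m := m) (b := b) (by omega)
    (Λ := (Finset.range H).filter (fun ℓ => ρ * ρ ≤ ℓ + b ∧ ℓ + b < H))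
    (fun ℓ hℓ => by simp only [Finset.mem_filter, Finset.mem_range] at hℓ; omega)
  rw [← sum_columns_truncated (c := a) (κ := 0) (m := m) (b := b) (by omega)
    (fun ℓ hℓ => by simp only [Finset.mem_filter, Finset.mem_range] at hℓ; omega), ← hK] at hlow
  have hup : |∑ i ∈ Finset.range (2 * ρ),
      ∑ y ∈ (Finset.range H).filter (fun ℓ => H + ρ * ρ ≤ ℓ + b), P (columnStart ρ H i + y)|
      ≤ if b ≤ ρ * ρ then 0 else shiftSum Φ H ρ (a + 1) := by
    split_ifs with hbe
    · rw [Finset.filter_false_of_mem]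
      · simp
      · intro ℓ hℓ
        rw [Finset.mem_range] at hℓ
        omega
    · have hup := abs_sum_columns_le hΦ hΓ hΓ1 (c := a + 1) (κ := H) (m := m) (b := b)
        (by rw [add_mul]; omega) (Λ := (Finset.range H).filter (fun ℓ => H + ρ * ρ ≤ ℓ + b))
        (fun ℓ hℓ => by simp only [Finset.mem_filter, Finset.mem_range] at hℓ; omega)
      rwa [← sum_columns_truncated (c := a + 1) (κ := H) (m := m) (b := b)
        (by rw [add_mul]; omega)
        (fun ℓ hℓ => by simp only [Finset.mem_filter, Finset.mem_range] at hℓ; omega),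
        ← hK] at hup
  have hbad := abs_sum_sum_le (n := 2 * ρ) (k := 2 * (ρ * ρ))
    (s := (Finset.range H).filter
            (fun ℓ => ¬ (ρ * ρ ≤ ℓ + b ∧ ℓ + b < H) ∧ ¬ (H + ρ * ρ ≤ ℓ + b)))
    (P := fun i y => P (columnStart ρ H i + y)) (fun i y => hP1 _) (by
      have h1 := card_filter_add_le H b 0 (ρ * ρ)
      have h2 := card_filter_add_le H b H (ρ * ρ)
      refine (Finset.card_le_card (t := ((Finset.range H).filter
        fun ℓ => 0 ≤ ℓ + b ∧ ℓ + b < 0 + ρ * ρ) ∪ ((Finset.range H).filter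
        fun ℓ => H ≤ ℓ + b ∧ ℓ + b < H + ρ * ρ)) ?_).trans
        ((Finset.card_union_le _ _).trans (by omega))
      intro ℓ hℓ
      simp only [Finset.mem_filter, Finset.mem_range, Finset.mem_union] at hℓ ⊢
      omega)
  simp_rw [hsplit, Finset.sum_add_distrib] at h0
  have hss : (stairSum ρ (2 * ρ) : ℝ) ≤ ρ * ρ := by exact_mod_cast stairSum_le ρ (2 * ρ) le_rfl
  push_cast at hbad
  rw [abs_le] at *
  constructor <;> linarith [h0.1, h0.2, hlow.1, hlow.2, hup.1, hup.2, hbad.1, hbad.2]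

/-- The part of the correlation from the positions that the shift by `m` moves out of the top of
their column. Within each half of the staircase, consecutive columns differ by one spacer, so the
slope is `1`. -/
theorem abs_exit_sum_le {ρ H : ℕ} {Φ Γ : ℕ → ℝ} (hρ : 1 ≤ ρ) (hΦ : IsColumnPeriodic ρ H Φ)
    (hΓ : IsColumnPeriodic ρ H Γ) (hΦ1 : ∀ y, |Φ y| ≤ 1) (hΓ1 : ∀ y, |Γ y| ≤ 1) {m : ℕ}
    (hm : m < H) :
    |∑ i ∈ Finset.range (2 * ρ), ∑ y ∈ Finset.range H,
        (if H ≤ y + m then Φ (columnStart ρ H i + y + m) * Γ (columnStart ρ H i + y) else 0)|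
      ≤ 2 * progressionSum Φ H 1 (ρ - 1) + 2 * H + (ρ * ρ : ℝ) * (2 * ρ) := by
  set Λ := (Finset.range H).filter (fun ℓ => H + ρ * ρ ≤ ℓ + m) with hΛ
  have hΛH : Λ.card ≤ H := (Finset.card_filter_le _ _).trans (by simp)
  set P : ℕ → ℕ → ℝ :=
    fun i y => Φ (columnStart ρ H i + y + m) * Γ (columnStart ρ H i + y) with hP
  have hP1 : ∀ i y, |P i y| ≤ 1 := fun i y => abs_mul_le_one (hΦ1 _) (hΓ1 _)
  have hsplit : ∀ i, ∑ y ∈ Finset.range H, (if H ≤ y + m then P i y else 0)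
      = ∑ y ∈ Λ, P i y
        + ∑ y ∈ (Finset.range H).filter (fun ℓ => H ≤ ℓ + m ∧ ℓ + m < H + ρ * ρ), P i y := by
    intro i
    rw [hΛ, Finset.sum_filter, Finset.sum_filter, ← Finset.sum_add_distrib]
    refine Finset.sum_congr rfl fun y _ => ?_
    by_cases h1 : H + ρ * ρ ≤ y + m
    · have h2 : H ≤ y + m := by omega
      have h3 : ¬ (y + m < H + ρ * ρ) := by omega
      simp [h1, h2, h3]
    · have h3 : y + m < H + ρ * ρ := by omega
      simp [h1, h3]
  have hmain := abs_sum_columns_le hΦ hΓ hΓ1 (c := 1) (κ := H) (m := m) (b := m)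
        (by omega) (Λ := Λ)
        (fun ℓ hℓ => by simp only [hΛ, Finset.mem_filter, Finset.mem_range] at hℓ; omega)
  have hbad := abs_sum_sum_le (n := 2 * ρ) hP1 (card_filter_add_le H m H (ρ * ρ))
  have hlast : |∑ y ∈ Λ, P (2 * ρ - 1) y| ≤ H :=
    (abs_sum_le_card (hP1 _)).trans (by exact_mod_cast hΛH)
  have hshift : shiftSum Φ H ρ 1 ≤ 2 * progressionSum Φ H 1 (ρ - 1) + H := by
    have : min 1 (2 * ρ - 1) = 1 := by omega
    rw [shiftSum, this]
    gcongr
    exact progressionSum_one_le hΦ1 _ _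
  have hlast' : ∑ i ∈ Finset.range (2 * ρ), ∑ y ∈ Λ, P i y
      = ∑ i ∈ Finset.range (2 * ρ - 1), ∑ y ∈ Λ, P i y + ∑ y ∈ Λ, P (2 * ρ - 1) y := by
    rw [← Finset.sum_range_succ (fun i => ∑ y ∈ Λ, P i y), Nat.sub_add_cancel (by omega)]
  change |∑ i ∈ Finset.range (2 * ρ), ∑ y ∈ Finset.range H, (if H ≤ y + m then P i y else 0)| ≤ _
  simp_rw [hsplit, Finset.sum_add_distrib]
  rw [hlast']
  push_cast at hbad
  rw [abs_le] at *
  constructor <;>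
    linarith [hmain.1, hmain.2, hbad.1, hbad.2, hlast.1, hlast.2, hshift]

/-- The correlation over a tower two steps later, as the sum of the part that stays inside the
columns of length `K` and the part that leaves them. -/
theorem abs_correlation_sum_le {ρ ρ' H K : ℕ} (hK : K = columnStart ρ H (2 * ρ)) (hρ' : 1 ≤ ρ')
    {Φ Γ : ℕ → ℝ} (hΦ : IsColumnPeriodic ρ H Φ) (hΓ : IsColumnPeriodic ρ H Γ)
    (hΦ' : IsColumnPeriodic ρ' K Φ) (hΓ' : IsColumnPeriodic ρ' K Γ)
    (hΦ1 : ∀ y, |Φ y| ≤ 1) (hΓ1 : ∀ y, |Γ y| ≤ 1) {m a b : ℕ}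
    (hm : m = a * H + b) (hb : b < H) (hmK : m < K) :
    |∑ z ∈ Finset.range (columnStart ρ' K (2 * ρ')), Φ (z + m) * Γ z|
      ≤ 2 * ρ' * (shiftSum Φ H ρ a + (if b ≤ ρ * ρ then 0 else shiftSum Φ H ρ (a + 1))
        + (ρ * ρ : ℝ) * (4 * ρ + 1))
        + (2 * progressionSum Φ K 1 (ρ' - 1) + 2 * K + (ρ' * ρ' : ℝ) * (2 * ρ' + 1)) := by
  have h0 := abs_sum_sub_sum_columns_le ρ' K (2 * ρ') (P := fun z => Φ (z + m) * Γ z)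
    (fun y => abs_mul_le_one (hΦ1 _) (hΓ1 _))
  have h1 := abs_inner_sum_le hΦ hΓ hΦ1 hΓ1 hm hb
  have h2 := abs_exit_sum_le hρ' hΦ' hΓ' hΦ1 hΓ1 hmK
  rw [← hK] at h1
  have hsplit : ∀ i ∈ Finset.range (2 * ρ'), ∑ y ∈ Finset.range K,
      Φ (columnStart ρ' K i + y + m) * Γ (columnStart ρ' K i + y)
      = ∑ y ∈ Finset.range K, (if y + m < K then Φ (y + m) * Γ y else 0)
        + ∑ y ∈ Finset.range K, (if K ≤ y + m then
            Φ (columnStart ρ' K i + y + m) * Γ (columnStart ρ' K i + y) else 0) := by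
    intro i hi
    rw [Finset.mem_range] at hi
    rw [← Finset.sum_add_distrib]
    refine Finset.sum_congr rfl fun y hy => ?_
    rw [Finset.mem_range] at hy
    by_cases h : y + m < K
    · rw [if_pos h, if_neg (by omega), add_zero, add_assoc, hΦ' i hi _ h, hΓ' i hi _ hy]
    · rw [if_neg h, if_pos (by omega), zero_add]
  rw [Finset.sum_congr rfl hsplit, Finset.sum_add_distrib, Finset.sum_const, Finset.card_range,
    nsmul_eq_mul] at h0
  have hss : (stairSum ρ' (2 * ρ') : ℝ) ≤ ρ' * ρ' := by
    exact_mod_cast stairSum_le ρ' (2 * ρ') le_rfl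
  have h3 : |((2 * ρ' : ℕ) : ℝ) *
      ∑ y ∈ Finset.range K, (if y + m < K then Φ (y + m) * Γ y else 0)|
      ≤ 2 * ρ' * (shiftSum Φ H ρ a + (if b ≤ ρ * ρ then 0 else shiftSum Φ H ρ (a + 1))
        + (ρ * ρ : ℝ) * (4 * ρ + 1)) := by
    rw [abs_mul, Nat.abs_cast]
    push_cast
    gcongr
  rw [abs_le] at *
  constructor <;> linarith [h0.1, h0.2, h2.1, h2.2, h3.1, h3.2]

/-! ### Towers -/

section Tower

variable {X : Type*} [MeasurableSpace X] {μ : Measure X} {T : X ≃ᵐ X}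

theorem image_iterate_image (a b : ℕ) (A : Set X) :
    T^[a] '' (T^[b] '' A) = T^[a + b] '' A := by
  rw [Function.iterate_add, Set.image_comp]

theorem measurableSet_image_iterate {A : Set X} (hA : MeasurableSet A) (n : ℕ) :
    MeasurableSet (T^[n] '' A) := by
  induction n with
  | zero => simpa using hA
  | succ n ih =>
    rw [Function.iterate_succ', Set.image_comp]
    exact T.measurableSet_image.2 ih

theorem measureReal_image_iterate (hT : MeasurePreserving T μ μ) (A : Set X) (n : ℕ) :
    μ.real (T^[n] '' A) = μ.real A := by
  induction n with
  | zero => simp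
  | succ n ih =>
    rw [Function.iterate_succ', Set.image_comp, ← ih]
    have := hT.measure_preimage_equiv (T '' (T^[n] '' A))
    rw [Set.preimage_image_eq _ T.injective] at this
    rw [measureReal_def, measureReal_def, ← this]

/-- The number of levels of the `j`-th tower. -/
def levelCount (h₁ : ℕ) (r' : ℕ → ℕ) (j : ℕ) : ℕ := dsHeight h₁ r' j + 1

variable {h₁ : ℕ} {r' : ℕ → ℕ} {E : ℕ → Set X} {C : ℕ → ℕ → Set X}

theorem levelCount_pos (j : ℕ) : 0 < levelCount h₁ r' j := Nat.succ_pos _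

theorem levelCount_succ (hr : ∀ j, 1 ≤ r' j) (j : ℕ) :
    levelCount h₁ r' (j + 1) = columnStart (r' j) (levelCount h₁ r' j) (2 * r' j) := by
  have := towerHeight_succ_add_one h₁ (fun j => 2 * r' j) (doubleStair r') j
    (by have := hr j; omega)
  rw [columnStart, levelCount, dsHeight, this, mul_comm]
  rfl

theorem columnStart_add_lt {ρ H i n ℓ : ℕ} (hi : i < n) (hℓ : ℓ < H) :
    columnStart ρ H i + ℓ < columnStart ρ H n := by
  have hmono : Monotone (columnStart ρ H) := monotone_nat_of_le_succ fun n => by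
    rw [columnStart_succ]; omega
  have h1 := hmono (show i + 1 ≤ n from hi)
  rw [columnStart_succ] at h1
  omega

/-- The space filled by the `j`-th tower. -/
def towerSet (T : X ≃ᵐ X) (h₁ : ℕ) (r' : ℕ → ℕ) (E : ℕ → Set X) (j : ℕ) : Set X :=
  ⋃ k ∈ Finset.range (levelCount h₁ r' j), T^[k] '' E j

namespace IsRankOneTower

section

variable (h : IsRankOneTower μ T h₁ (fun j => 2 * r' j) (doubleStair r') E C)

include h

theorem piece_eq (j i : ℕ) (hi : i < 2 * r' j) :
    C j i = T^[columnStart (r' j) (levelCount h₁ r' j) i] '' E (j + 1) := by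
  induction i with
  | zero => simp [columnStart, h.base_succ]
  | succ i ih =>
    rw [← h.next_column j i hi, ih (by omega), image_iterate_image, columnStart_succ]
    congr 2
    change dsHeight h₁ r' j + (if i < r' j then i else i - r' j) + 1 + _ = _
    rw [levelCount]
    omega

theorem base_eq_iUnion (j : ℕ) :
    E j = ⋃ i ∈ Finset.range (2 * r' j),
      T^[columnStart (r' j) (levelCount h₁ r' j) i] '' E (j + 1) := by
  rw [h.base_eq j]
  simp only [Finset.mem_range]
  exact Set.iUnion₂_congr fun i hi => h.piece_eq j i hi

theorem iterate_mem_base {j i : ℕ} (hi : i < 2 * r' j) {x : X} (hx : x ∈ E (j + 1)) :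
    T^[columnStart (r' j) (levelCount h₁ r' j) i] x ∈ E j := by
  rw [h.base_eq_iUnion j]
  simp only [Finset.mem_range, Set.mem_iUnion]
  exact ⟨i, hi, x, hx, rfl⟩

theorem base_succ_subset (hr : ∀ j, 1 ≤ r' j) (j : ℕ) : E (j + 1) ⊆ E j := fun x hx => by
  have := h.iterate_mem_base (i := 0) (by have := hr j; omega) hx
  rwa [columnStart_zero] at this

theorem disjoint_image {j k l : ℕ} (hk : k < levelCount h₁ r' j) (hl : l < levelCount h₁ r' j)
    (hkl : k ≠ l) : Disjoint (T^[k] '' E j) (T^[l] '' E j) :=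
  h.disjoint_levels j k (Nat.lt_succ_iff.1 hk) l (Nat.lt_succ_iff.1 hl) hkl

theorem pairwiseDisjoint_levels (j : ℕ) :
    Set.PairwiseDisjoint (↑(Finset.range (levelCount h₁ r' j))) (fun k => T^[k] '' E j) := by
  intro k hk l hl hkl
  exact h.disjoint_image (by simpa using hk) (by simpa using hl) hkl

theorem measurableSet_level (j k : ℕ) : MeasurableSet (T^[k] '' E j) :=
  measurableSet_image_iterate (h.measurableSet_base j) k

theorem measurableSet_towerSet (j : ℕ) : MeasurableSet (towerSet T h₁ r' E j) :=
  Finset.measurableSet_biUnion _ fun k _ => h.measurableSet_level j k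

variable [IsProbabilityMeasure μ] (hT : MeasurePreserving T μ μ)

include hT

theorem measureReal_base (j : ℕ) : μ.real (E j) = 2 * r' j * μ.real (E (j + 1)) := by
  conv_lhs => rw [h.base_eq_iUnion j]
  rw [measureReal_biUnion_finset]
  · simp_rw [measureReal_image_iterate hT]
    simp
  · intro i hi i' hi' hii'
    simp only [Finset.coe_range, Set.mem_Iio] at hi hi'
    simp only [Function.onFun]
    rw [← h.piece_eq j i hi, ← h.piece_eq j i' hi']
    exact h.disjoint_pieces j i hi i' hi' hii'
  · exact fun i _ => h.measurableSet_level _ _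

theorem measureReal_towerSet (j : ℕ) :
    μ.real (towerSet T h₁ r' E j) = levelCount h₁ r' j * μ.real (E j) := by
  rw [towerSet, measureReal_biUnion_finset (h.pairwiseDisjoint_levels j)
    fun k _ => h.measurableSet_level j k]
  simp_rw [measureReal_image_iterate hT]
  simp

theorem levelCount_mul_measureReal_le (j : ℕ) :
    levelCount h₁ r' j * μ.real (E j) ≤ 1 := by
  rw [← h.measureReal_towerSet hT]
  exact measureReal_le_one

theorem monotone_measureReal_towerSet (hr : ∀ j, 1 ≤ r' j) :
    Monotone fun j => μ.real (towerSet T h₁ r' E j) := by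
  refine monotone_nat_of_le_succ fun j => ?_
  rw [h.measureReal_towerSet hT, h.measureReal_towerSet hT, h.measureReal_base hT,
    levelCount_succ hr, columnStart_eq]
  push_cast
  have h1 : (0 : ℝ) ≤ μ.real (E (j + 1)) := measureReal_nonneg
  have h2 : (0 : ℝ) ≤ stairSum (r' j) (2 * r' j) := Nat.cast_nonneg _
  nlinarith [mul_nonneg h1 h2]

theorem tendsto_measureReal_towerSet (hr : ∀ j, 1 ≤ r' j) :
    Tendsto (fun j => μ.real (towerSet T h₁ r' E j)) atTop (𝓝 1) := by
  refine tendsto_order.2 ⟨fun a ha => ?_, fun a ha =>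
    Eventually.of_forall fun j => measureReal_le_one.trans_lt ha⟩
  obtain ⟨j, S, hS, hlt⟩ := h.generating Set.univ MeasurableSet.univ (ENNReal.ofReal (1 - a))
    (by simpa using ha)
  have hsub : (towerSet T h₁ r' E j)ᶜ ⊆ symmDiff Set.univ (⋃ k ∈ S, T^[k] '' E j) := by
    intro x hx
    refine Or.inl ⟨trivial, fun hx' => hx ?_⟩
    simp only [Set.mem_iUnion] at hx'
    obtain ⟨k, hk, hxk⟩ := hx'
    simp only [towerSet, Set.mem_iUnion, Finset.mem_range]
    exact ⟨k, Nat.lt_succ_of_le (hS k hk), hxk⟩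
  have h1 : μ.real (towerSet T h₁ r' E j)ᶜ < 1 - a :=
    (ENNReal.lt_ofReal_iff_toReal_lt (measure_ne_top _ _)).1 ((measure_mono hsub).trans_lt hlt)
  rw [probReal_compl_eq_one_sub (h.measurableSet_towerSet j)] at h1
  filter_upwards [eventually_ge_atTop j] with i hi
  have := h.monotone_measureReal_towerSet hT hr hi
  simp only at this
  linarith

theorem base_nonempty (hr : ∀ j, 1 ≤ r' j) (j : ℕ) : (E j).Nonempty := by
  by_contra hne
  rw [Set.not_nonempty_iff_eq_empty] at hne
  have hanti : Antitone E := antitone_nat_of_succ_le fun j => h.base_succ_subset hr j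
  have hlim := h.tendsto_measureReal_towerSet hT hr
  have hev : ∀ᶠ i in atTop, μ.real (towerSet T h₁ r' E i) = 0 := by
    filter_upwards [eventually_ge_atTop j] with i hi
    have : E i = ∅ := Set.subset_empty_iff.1 (hne ▸ hanti hi)
    rw [h.measureReal_towerSet hT, this]
    simp
  exact zero_ne_one (tendsto_nhds_unique (tendsto_const_nhds.congr' (hev.mono fun _ h => h.symm))
    hlim)

end

end IsRankOneTower

/-- `A` is a union of levels of the `j`-th tower. -/
def IsLevelUnion (T : X ≃ᵐ X) (h₁ : ℕ) (r' : ℕ → ℕ) (E : ℕ → Set X) (j : ℕ) (A : Set X) : Prop :=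
  ∃ S : Set ℕ, (∀ k ∈ S, k < levelCount h₁ r' j) ∧ A = ⋃ k ∈ S, T^[k] '' E j

/-- `f` is measurable, bounded by `1`, and constant on each level of the `j`-th tower. Nothing is
required outside the tower. -/
structure IsLevelFun (T : X ≃ᵐ X) (h₁ : ℕ) (r' : ℕ → ℕ) (E : ℕ → Set X) (j : ℕ) (f : X → ℝ) :
    Prop where
  measurable : Measurable f
  abs_le_one : ∀ x, |f x| ≤ 1
  const_on_level : ∀ l < levelCount h₁ r' j, ∀ x ∈ E j, ∀ y ∈ E j, f (T^[l] x) = f (T^[l] y)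

namespace IsRankOneTower

variable (h : IsRankOneTower μ T h₁ (fun j => 2 * r' j) (doubleStair r') E C)

include h

theorem isLevelUnion_succ (hr : ∀ j, 1 ≤ r' j) {j : ℕ} {A : Set X}
    (hA : IsLevelUnion T h₁ r' E j A) : IsLevelUnion T h₁ r' E (j + 1) A := by
  obtain ⟨S, hS, rfl⟩ := hA
  refine ⟨{y | ∃ i < 2 * r' j, ∃ l ∈ S, y = columnStart (r' j) (levelCount h₁ r' j) i + l},
    ?_, ?_⟩
  · rintro _ ⟨i, hi, l, hl, rfl⟩
    rw [levelCount_succ hr]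
    exact columnStart_add_lt hi (hS l hl)
  · ext x
    simp only [Set.mem_iUnion, Set.mem_ofPred_eq]
    constructor
    · rintro ⟨l, hl, y, hy, rfl⟩
      rw [h.base_eq_iUnion j] at hy
      simp only [Set.mem_iUnion, Finset.mem_range] at hy
      obtain ⟨i, hi, z, hz, rfl⟩ := hy
      refine ⟨_, ⟨i, hi, l, hl, rfl⟩, z, hz, ?_⟩
      rw [add_comm, Function.iterate_add_apply]
    · rintro ⟨_, ⟨i, hi, l, hl, rfl⟩, z, hz, rfl⟩
      refine ⟨l, hl, _, h.iterate_mem_base hi hz, ?_⟩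
      rw [add_comm, Function.iterate_add_apply]

theorem isLevelUnion_of_le (hr : ∀ j, 1 ≤ r' j) {j k : ℕ} (hjk : j ≤ k) {A : Set X}
    (hA : IsLevelUnion T h₁ r' E j A) : IsLevelUnion T h₁ r' E k A := by
  induction k, hjk using Nat.le_induction with
  | base => exact hA
  | succ k _ ih => exact h.isLevelUnion_succ hr ih

theorem measurableSet_of_isLevelUnion {j : ℕ} {A : Set X} (hA : IsLevelUnion T h₁ r' E j A) :
    MeasurableSet A := by
  obtain ⟨S, -, rfl⟩ := hA
  exact MeasurableSet.biUnion S.to_countable fun k _ => h.measurableSet_level j k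

theorem iterate_mem_iff {j : ℕ} {S : Set ℕ} (hS : ∀ k ∈ S, k < levelCount h₁ r' j) {l : ℕ}
    (hl : l < levelCount h₁ r' j) {x : X} (hx : x ∈ E j) :
    T^[l] x ∈ ⋃ k ∈ S, T^[k] '' E j ↔ l ∈ S := by
  simp only [Set.mem_iUnion]
  constructor
  · rintro ⟨k, hk, hkx⟩
    by_contra hlS
    exact Set.disjoint_left.1 (h.disjoint_image (hS k hk) hl (fun e => hlS (e ▸ hk))) hkx
      ⟨x, hx, rfl⟩
  · exact fun hlS => ⟨l, hlS, x, hx, rfl⟩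

theorem isLevelFun_indicator_sub {j : ℕ} {A : Set X} (hA : IsLevelUnion T h₁ r' E j A) {c : ℝ}
    (hc0 : 0 ≤ c) (hc1 : c ≤ 1) :
    IsLevelFun T h₁ r' E j (fun x => A.indicator (fun _ => (1 : ℝ)) x - c) := by
  have hAm := h.measurableSet_of_isLevelUnion hA
  obtain ⟨S, hS, rfl⟩ := hA
  refine ⟨(measurable_const.indicator hAm).sub_const c, fun x => ?_, fun l hl x hx y hy => ?_⟩
  · by_cases hx : x ∈ ⋃ k ∈ S, T^[k] '' E j
    · rw [Set.indicator_of_mem hx, abs_le]; constructor <;> linarith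
    · rw [Set.indicator_of_notMem hx, abs_le]; constructor <;> linarith
  · have ex := h.iterate_mem_iff hS hl hx
    have ey := h.iterate_mem_iff hS hl hy
    by_cases hlS : l ∈ S
    · simp [Set.indicator_of_mem (ex.2 hlS), Set.indicator_of_mem (ey.2 hlS)]
    · simp [Set.indicator_of_notMem (mt ex.1 hlS), Set.indicator_of_notMem (mt ey.1 hlS)]

theorem isColumnPeriodic_word {j : ℕ} (hr : ∀ j, 1 ≤ r' j) {f : X → ℝ}
    (hf : IsLevelFun T h₁ r' E j f) {x : X} (hx : x ∈ E (j + 1)) :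
    IsColumnPeriodic (r' j) (levelCount h₁ r' j) (fun y => f (T^[y] x)) := by
  intro i hi l hl
  change f (T^[_] x) = f (T^[l] x)
  rw [add_comm, Function.iterate_add_apply]
  exact hf.const_on_level l hl _ (h.iterate_mem_base hi hx) _ (h.base_succ_subset hr j hx)

variable [IsProbabilityMeasure μ] (hT : MeasurePreserving T μ μ)

include hT

/-- A correlation integral is the correlation of the words that `f` and `g` spell along a tower, up
to the measure of the complement of the tower and the `m` topmost levels. -/
theorem abs_integral_sub_le {j : ℕ} {f g : X → ℝ} (hf : IsLevelFun T h₁ r' E j f)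
    (hg : IsLevelFun T h₁ r' E j g) {x₀ : X} (hx₀ : x₀ ∈ E j) (m : ℕ) :
    |∫ x, f (T^[m] x) * g x ∂μ
        - μ.real (E j) * ∑ z ∈ Finset.range (levelCount h₁ r' j),
          f (T^[z + m] x₀) * g (T^[z] x₀)|
      ≤ (1 - μ.real (towerSet T h₁ r' E j)) + 2 * m * μ.real (E j) := by
  set F : X → ℝ := fun x => f (T^[m] x) * g x with hF
  have hF1 : ∀ x, |F x| ≤ 1 := fun x => abs_mul_le_one (hf.abs_le_one _) (hg.abs_le_one _)
  have hTm : Measurable (T^[m]) := T.measurable.iterate m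
  have hFm : Measurable F := (hf.measurable.comp hTm).mul hg.measurable
  have hFi : Integrable F μ := Integrable.of_bound hFm.aestronglyMeasurable 1
    (Eventually.of_forall fun x => hF1 x)
  have hset : ∀ A : Set X, |∫ x in A, F x ∂μ| ≤ μ.real A := fun A => by
    have := norm_setIntegral_le_of_norm_le_const (μ := μ) (f := F) (C := 1) (s := A)
      (measure_lt_top _ _) (fun x _ => hF1 x)
    simpa using this
  set N := levelCount h₁ r' j with hN
  have hsplit : ∫ x, F x ∂μ = ∑ z ∈ Finset.range N, ∫ x in T^[z] '' E j, F x ∂μ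
      + ∫ x in (towerSet T h₁ r' E j)ᶜ, F x ∂μ := by
    rw [← integral_add_compl (h.measurableSet_towerSet j) hFi]
    congr 1
    rw [towerSet, integral_biUnion_finset _ (fun k _ => h.measurableSet_level j k)
      (h.pairwiseDisjoint_levels j) fun k _ => hFi.integrableOn]
  have hlevel : ∀ z ∈ Finset.range N, |∫ x in T^[z] '' E j, F x ∂μ
      - μ.real (E j) * (f (T^[z + m] x₀) * g (T^[z] x₀))|
      ≤ if N ≤ z + m then 2 * μ.real (E j) else 0 := by
    intro z hz
    rw [Finset.mem_range] at hz
    have hzm : ∀ w, T^[m] (T^[z] w) = T^[z + m] w := fun w => by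
      rw [add_comm, Function.iterate_add_apply]
    split_ifs with hlt
    · have h1 := hset (T^[z] '' E j)
      rw [measureReal_image_iterate hT] at h1
      have h2 : |μ.real (E j) * (f (T^[z + m] x₀) * g (T^[z] x₀))| ≤ μ.real (E j) := by
        rw [abs_mul, abs_of_nonneg measureReal_nonneg]
        exact mul_le_of_le_one_right measureReal_nonneg
          (abs_mul_le_one (hf.abs_le_one _) (hg.abs_le_one _))
      exact (abs_sub _ _).trans (by linarith)
    · have : ∫ x in T^[z] '' E j, F x ∂μ
          = ∫ x in T^[z] '' E j, f (T^[z + m] x₀) * g (T^[z] x₀) ∂μ := by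
        refine setIntegral_congr_fun (h.measurableSet_level j z) ?_
        rintro _ ⟨w, hw, rfl⟩
        simp only [hF]
        rw [hzm, hf.const_on_level (z + m) (by omega) w hw x₀ hx₀,
          hg.const_on_level z hz w hw x₀ hx₀]
      rw [this, setIntegral_const, measureReal_image_iterate hT, smul_eq_mul, sub_self, abs_zero]
  have hcard : ∑ z ∈ Finset.range N, (if N ≤ z + m then 2 * μ.real (E j) else 0)
      ≤ 2 * m * μ.real (E j) := by
    rw [← Finset.sum_filter, Finset.sum_const, nsmul_eq_mul]
    have hc : ((Finset.range N).filter (fun z => N ≤ z + m)).card ≤ m := by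
      refine (Finset.card_le_card (t := Finset.Ico (N - m) N) ?_).trans (by simp; omega)
      intro z hz
      simp only [Finset.mem_filter, Finset.mem_range, Finset.mem_Ico] at hz ⊢
      omega
    have hc' : ((((Finset.range N).filter (fun z => N ≤ z + m)).card : ℕ) : ℝ) ≤ m := by
      exact_mod_cast hc
    nlinarith [measureReal_nonneg (μ := μ) (s := E j)]
  have hout := hset (towerSet T h₁ r' E j)ᶜ
  rw [probReal_compl_eq_one_sub (h.measurableSet_towerSet j)] at hout
  rw [hsplit, Finset.mul_sum, add_sub_right_comm, ← Finset.sum_sub_distrib]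
  refine (abs_add_le _ _).trans ?_
  have := (Finset.abs_sum_le_sum_abs _ _).trans ((Finset.sum_le_sum hlevel).trans hcard)
  linarith

theorem measureReal_mul_progressionSum_le {j : ℕ} {f : X → ℝ} (hf : IsLevelFun T h₁ r' E j f)
    {x₀ : X} (hx₀ : x₀ ∈ E j) (σ L : ℕ) :
    μ.real (E j) * progressionSum (fun y => f (T^[y] x₀)) (levelCount h₁ r' j) σ L
      ≤ ∫ x, |∑ i ∈ Finset.range L, f (T^[σ * i] x)| ∂μ := by
  set G : X → ℝ := fun x => |∑ i ∈ Finset.range L, f (T^[σ * i] x)| with hG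
  have hGm : Measurable G := by
    have : Measurable fun x => ∑ i ∈ Finset.range L, f (T^[σ * i] x) :=
      Finset.measurable_sum _ fun i _ => hf.measurable.comp (T.measurable.iterate _)
    exact this.abs
  have hGb : ∀ x, |G x| ≤ L := fun x => by
    rw [hG, abs_abs]
    exact (Finset.abs_sum_le_sum_abs _ _).trans
      ((Finset.sum_le_card_nsmul _ _ 1 fun y _ => hf.abs_le_one _).trans (by simp))
  have hGi : Integrable G μ := Integrable.of_bound hGm.aestronglyMeasurable L
    (Eventually.of_forall fun x => hGb x)
  set N := levelCount h₁ r' j with hN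
  set s := (Finset.range N).filter (fun u => u + σ * (L - 1) < N) with hs
  have hsN : ∀ u ∈ s, u < N ∧ u + σ * (L - 1) < N := fun u hu => by
    simpa [hs] using hu
  have hlevel : ∀ u ∈ s, ∫ x in T^[u] '' E j, G x ∂μ
      = μ.real (E j) * |∑ i ∈ Finset.range L, f (T^[u + σ * i] x₀)| := by
    intro u hu
    have : ∫ x in T^[u] '' E j, G x ∂μ
        = ∫ x in T^[u] '' E j, |∑ i ∈ Finset.range L, f (T^[u + σ * i] x₀)| ∂μ := by
      refine setIntegral_congr_fun (h.measurableSet_level j u) ?_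
      rintro _ ⟨w, hw, rfl⟩
      simp only [hG]
      congr 1
      refine Finset.sum_congr rfl fun i hi => ?_
      rw [Finset.mem_range] at hi
      have h1 : σ * i ≤ σ * (L - 1) := Nat.mul_le_mul_left _ (by omega)
      have h2 := (hsN u hu).2
      rw [← Function.iterate_add_apply, add_comm]
      exact hf.const_on_level _ (by omega) w hw x₀ hx₀
    rw [this, setIntegral_const, measureReal_image_iterate hT, smul_eq_mul]
  rw [progressionSum, Finset.mul_sum, ← Finset.sum_congr rfl hlevel,
    ← integral_biUnion_finset _ (fun k _ => h.measurableSet_level j k) ?_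
      fun k _ => hGi.integrableOn]
  · exact setIntegral_le_integral hGi (Eventually.of_forall fun x => abs_nonneg _)
  · exact (h.pairwiseDisjoint_levels j).subset (by
      intro u hu
      simpa using (hsN u hu).1)

end IsRankOneTower

end Tower

/-! ### Correlations between two heights -/

section Stage

variable {X : Type*} [MeasurableSpace X] {μ : Measure X} {T : X ≃ᵐ X}

/-- The `L¹` norm of the sum of the functions `f ∘ T ^ (σ * i)`, `i < L`. -/
noncomputable def powerSumNorm (μ : Measure X) (T : X ≃ᵐ X) (f : X → ℝ) (σ L : ℕ) : ℝ :=
  ∫ x, |∑ i ∈ Finset.range L, f (T^[σ * i] x)| ∂μ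

theorem powerSumNorm_nonneg (f : X → ℝ) (σ L : ℕ) : 0 ≤ powerSumNorm μ T f σ L :=
  integral_nonneg fun _ => abs_nonneg _

theorem powerSumNorm_zero (f : X → ℝ) (σ : ℕ) : powerSumNorm μ T f σ 0 = 0 := by
  simp [powerSumNorm]

theorem powerSumNorm_le [IsProbabilityMeasure μ] {f : X → ℝ} (hf : ∀ x, |f x| ≤ 1) (σ L : ℕ) :
    powerSumNorm μ T f σ L ≤ L := by
  have := norm_integral_le_of_norm_le_const (μ := μ)
    (f := fun x => |∑ i ∈ Finset.range L, f (T^[σ * i] x)|) (C := L)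
    (Eventually.of_forall fun x => by
      rw [Real.norm_eq_abs, abs_abs]
      exact (Finset.abs_sum_le_sum_abs _ _).trans
        ((Finset.sum_le_card_nsmul _ _ 1 fun y _ => hf _).trans (by simp)))
  simp only [probReal_univ, mul_one] at this
  exact (le_abs_self _).trans this

/-- The bound `shiftSum`, with the sums along progressions in a tower replaced by norms of power
sums. -/
noncomputable def shiftNorm (μ : Measure X) (T : X ≃ᵐ X) (f : X → ℝ) (ρ c : ℕ) : ℝ :=
  2 * powerSumNorm μ T f c (ρ - c)
    + powerSumNorm μ T f ((c - ρ) + (ρ - c)) (min c (2 * ρ - c))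

variable {h₁ : ℕ} {r' : ℕ → ℕ} {E : ℕ → Set X} {C : ℕ → ℕ → Set X}

/-- The part of the bound for correlations at step `j` that does not depend on the functions. It
tends to `0` because the towers exhaust the space, the numbers of cuts grow, and the numbers of
spacers are small compared with the heights. -/
noncomputable def stageError (μ : Measure X) (T : X ≃ᵐ X) (h₁ : ℕ) (r' : ℕ → ℕ) (E : ℕ → Set X)
    (j : ℕ) : ℝ :=
  (1 - μ.real (towerSet T h₁ r' E (j + 2))) + 2 / (r' (j + 1) : ℝ)
    + 5 / 2 * ((r' j : ℝ) ^ 2 / levelCount h₁ r' j)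
    + 3 / 2 * ((r' (j + 1) : ℝ) ^ 2 / levelCount h₁ r' (j + 1))

theorem succ_le_levelCount (hr : ∀ j, 1 ≤ r' j) (j : ℕ) : j + 1 ≤ levelCount h₁ r' j := by
  induction j with
  | zero => exact levelCount_pos 0
  | succ j ih =>
    rw [levelCount_succ hr, columnStart_eq]
    have h1 : 2 * levelCount h₁ r' j ≤ 2 * r' j * levelCount h₁ r' j :=
      Nat.mul_le_mul_right _ (by have := hr j; omega)
    omega

theorem tendsto_sq_div_levelCount (hr : ∀ j, 1 ≤ r' j)
    (hr_adams : Tendsto (fun j => ((2 * r' j : ℕ) : ℝ) ^ 2 / (dsHeight h₁ r' j : ℝ)) atTop (𝓝 0)) :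
    Tendsto (fun j => (r' j : ℝ) ^ 2 / levelCount h₁ r' j) atTop (𝓝 0) := by
  refine squeeze_zero' (Eventually.of_forall fun j => by positivity) ?_ hr_adams
  filter_upwards [eventually_ge_atTop 1] with j hj
  have h1 := succ_le_levelCount (h₁ := h₁) hr j
  have h2 : 0 < dsHeight h₁ r' j := by rw [levelCount] at h1; omega
  have h3 : (0 : ℝ) < dsHeight h₁ r' j := by exact_mod_cast h2
  rw [levelCount]
  push_cast
  gcongr
  · have : (0 : ℝ) ≤ r' j := Nat.cast_nonneg _
    linarith
  · linarith

namespace IsRankOneTower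

variable (h : IsRankOneTower μ T h₁ (fun j => 2 * r' j) (doubleStair r') E C)

include h

variable [IsProbabilityMeasure μ] (hT : MeasurePreserving T μ μ)

include hT

theorem tendsto_stageError (hr : ∀ j, 1 ≤ r' j) (hr_top : Tendsto r' atTop atTop)
    (hr_adams : Tendsto (fun j => ((2 * r' j : ℕ) : ℝ) ^ 2 / (dsHeight h₁ r' j : ℝ)) atTop (𝓝 0)) :
    Tendsto (stageError μ T h₁ r' E) atTop (𝓝 0) := by
  have h1 := (tendsto_add_atTop_iff_nat 2).2 (h.tendsto_measureReal_towerSet hT hr)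
  have h2 := tendsto_sq_div_levelCount hr hr_adams
  have h3 := (tendsto_add_atTop_iff_nat 1).2 h2
  have h4 : Tendsto (fun j => 2 / (r' (j + 1) : ℝ)) atTop (𝓝 0) :=
    ((tendsto_add_atTop_iff_nat 1).2
      (tendsto_natCast_atTop_atTop.comp hr_top)).const_div_atTop 2
  have := (((tendsto_const_nhds (x := (1 : ℝ))).sub h1).add h4).add (h2.const_mul (5 / 2)) |>.add
    (h3.const_mul (3 / 2))
  simp only [sub_self, mul_zero, add_zero] at this
  exact this

/-- The basic estimate for the correlation at a time `m` between two consecutive heights: it is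
small when the power sums with the slopes that occur for shifts by `a` and by `a + 1` columns are
small. -/
theorem abs_integral_le (hr : ∀ j, 1 ≤ r' j) {j : ℕ} {f g : X → ℝ}
    (hf : ∀ k ≥ j, IsLevelFun T h₁ r' E k f) (hg : ∀ k ≥ j, IsLevelFun T h₁ r' E k g)
    {m a b : ℕ} (hm : m = a * levelCount h₁ r' j + b) (hb : b < levelCount h₁ r' j)
    (hmK : m < levelCount h₁ r' (j + 1)) :
    |∫ x, f (T^[m] x) * g x ∂μ|
      ≤ 1 / (2 * r' j) * (shiftNorm μ T f (r' j) a
          + if b ≤ r' j * r' j then 0 else shiftNorm μ T f (r' j) (a + 1))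
        + 1 / r' (j + 1) * powerSumNorm μ T f 1 (r' (j + 1) - 1) + stageError μ T h₁ r' E j := by
  -- one point of the base two steps later spells words that serve at all three steps
  obtain ⟨x₀, hx₂⟩ := h.base_nonempty hT hr (j + 2)
  have hx₁ := h.base_succ_subset hr _ hx₂
  have hx₀ := h.base_succ_subset hr _ hx₁
  set Φ : ℕ → ℝ := fun y => f (T^[y] x₀) with hΦ
  set Γ : ℕ → ℝ := fun y => g (T^[y] x₀) with hΓ
  set H := levelCount h₁ r' j with hH
  set K := levelCount h₁ r' (j + 1) with hK
  set ρ := r' j with hρ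
  set ρ' := r' (j + 1) with hρ'
  have hj := hf j le_rfl
  have hj1 := hf (j + 1) (by omega)
  have hcorr := abs_correlation_sum_le (levelCount_succ hr j) (hr (j + 1))
    (h.isColumnPeriodic_word hr hj hx₁) (h.isColumnPeriodic_word hr (hg j le_rfl) hx₁)
    (h.isColumnPeriodic_word hr hj1 hx₂)
    (h.isColumnPeriodic_word hr (hg (j + 1) (by omega)) hx₂)
    (fun y => hj.abs_le_one _) (fun y => (hg j le_rfl).abs_le_one _) hm hb hmK
  rw [← levelCount_succ hr (j + 1)] at hcorr
  have hint := h.abs_integral_sub_le hT (hf (j + 2) (by omega)) (hg (j + 2) (by omega)) hx₂ m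
  have hV0 := h.measureReal_mul_progressionSum_le hT hj hx₀
  have hV1 := h.measureReal_mul_progressionSum_le hT hj1 hx₁
  have hE0 := h.measureReal_base hT j
  have hE1 := h.measureReal_base hT (j + 1)
  have hH1 := h.levelCount_mul_measureReal_le hT j
  have hK1 := h.levelCount_mul_measureReal_le hT (j + 1)
  rw [← hρ] at hE0
  rw [← hρ'] at hE1
  rw [← hH] at hH1
  rw [← hK] at hK1
  have hε2 : 0 ≤ μ.real (E (j + 2)) := measureReal_nonneg
  change μ.real (E (j + 1)) = 2 * ρ' * μ.real (E (j + 2)) at hE1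
  have hρ0 : (0 : ℝ) < ρ := by exact_mod_cast hr j
  have hρ0' : (0 : ℝ) < ρ' := by exact_mod_cast hr (j + 1)
  have hρ1 : (1 : ℝ) ≤ ρ := by exact_mod_cast hr j
  have hρ1' : (1 : ℝ) ≤ ρ' := by exact_mod_cast hr (j + 1)
  have hHpos : (0 : ℝ) < H := by exact_mod_cast levelCount_pos j
  have hKpos : (0 : ℝ) < K := by exact_mod_cast levelCount_pos (j + 1)
  have hmK' : (m : ℝ) ≤ K := by exact_mod_cast hmK.le
  set ε0 := μ.real (E j)
  set ε1 := μ.real (E (j + 1))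
  set ε2 := μ.real (E (j + 2))
  have hshift : ∀ c, ε1 * shiftSum Φ H ρ c ≤ 1 / (2 * ρ) * shiftNorm μ T f ρ c := by
    intro c
    have h1 := hV0 c (ρ - c)
    have h2 := hV0 ((c - ρ) + (ρ - c)) (min c (2 * ρ - c))
    have : ε1 * shiftSum Φ H ρ c = 1 / (2 * ρ) * (ε0 * shiftSum Φ H ρ c) := by
      rw [hE0]; field_simp
    rw [this, shiftSum, shiftNorm]
    refine mul_le_mul_of_nonneg_left ?_ (by positivity)
    simp only [powerSumNorm]
    linarith
  have hinner : ε1 * (shiftSum Φ H ρ a + (if b ≤ ρ * ρ then 0 else shiftSum Φ H ρ (a + 1)))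
      ≤ 1 / (2 * ρ) * (shiftNorm μ T f ρ a
          + if b ≤ ρ * ρ then 0 else shiftNorm μ T f ρ (a + 1)) := by
    split_ifs
    · simpa using hshift a
    · rw [mul_add, mul_add]
      exact add_le_add (hshift a) (hshift (a + 1))
  have hexit : ε2 * (2 * progressionSum Φ K 1 (ρ' - 1))
      ≤ 1 / ρ' * powerSumNorm μ T f 1 (ρ' - 1) := by
    have : ε2 * (2 * progressionSum Φ K 1 (ρ' - 1))
        = 1 / ρ' * (ε1 * progressionSum Φ K 1 (ρ' - 1)) := by
      rw [hE1]; field_simp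
    rw [this]
    exact mul_le_mul_of_nonneg_left (hV1 1 (ρ' - 1)) (by positivity)
  have herr1 : ε1 * ((ρ * ρ : ℝ) * (4 * ρ + 1)) ≤ 5 / 2 * ((ρ : ℝ) ^ 2 / H) := by
    have h1 : ε1 * (2 * ρ * H) ≤ 1 := by rw [hE0] at hH1; linarith
    have h2 : 5 / 2 * ((ρ : ℝ) ^ 2 / H) = (5 * ρ * ρ * ρ) * (1 / (2 * ρ * H)) := by
      field_simp
    have h3 : ε1 ≤ 1 / (2 * ρ * H) := (le_div_iff₀ (by positivity)).2 h1
    rw [h2, mul_comm]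
    refine mul_le_mul ?_ h3 measureReal_nonneg (by positivity)
    nlinarith [mul_pos hρ0 hρ0]
  have hεK : ε2 ≤ 1 / (2 * ρ' * K) := by
    rw [le_div_iff₀ (by positivity)]
    rw [hE1] at hK1; linarith
  have herr2 : ε2 * ((ρ' * ρ' : ℝ) * (2 * ρ' + 1)) ≤ 3 / 2 * ((ρ' : ℝ) ^ 2 / K) := by
    have h2 : 3 / 2 * ((ρ' : ℝ) ^ 2 / K) = (3 * ρ' * ρ' * ρ') * (1 / (2 * ρ' * K)) := by
      field_simp
    rw [h2, mul_comm]
    refine mul_le_mul ?_ hεK hε2 (by positivity)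
    nlinarith [mul_pos hρ0' hρ0']
  have herr3 : 2 * m * ε2 + ε2 * (2 * K) ≤ 2 / ρ' := by
    have h2 : (2 : ℝ) / ρ' = 4 * K * (1 / (2 * ρ' * K)) := by field_simp; norm_num
    rw [h2]
    nlinarith [mul_le_mul_of_nonneg_left hmK' hε2, mul_le_mul_of_nonneg_left hεK hKpos.le]
  have htotal := mul_le_mul_of_nonneg_left hcorr hε2
  have hexp : ε2 * (2 * ρ' * (shiftSum Φ H ρ a + (if b ≤ ρ * ρ then 0 else shiftSum Φ H ρ (a + 1))
        + (ρ * ρ : ℝ) * (4 * ρ + 1))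
        + (2 * progressionSum Φ K 1 (ρ' - 1) + 2 * K + (ρ' * ρ' : ℝ) * (2 * ρ' + 1)))
      = ε1 * (shiftSum Φ H ρ a + (if b ≤ ρ * ρ then 0 else shiftSum Φ H ρ (a + 1)))
        + ε1 * ((ρ * ρ : ℝ) * (4 * ρ + 1)) + ε2 * (2 * progressionSum Φ K 1 (ρ' - 1))
        + ε2 * (2 * K) + ε2 * ((ρ' * ρ' : ℝ) * (2 * ρ' + 1)) := by
    rw [hE1]; ring
  rw [hexp] at htotal
  have habs : |∫ x, f (T^[m] x) * g x ∂μ| ≤ (1 - μ.real (towerSet T h₁ r' E (j + 2)))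
      + 2 * m * ε2 + ε2 * |∑ z ∈ Finset.range (levelCount h₁ r' (j + 2)),
          f (T^[z + m] x₀) * g (T^[z] x₀)| := by
    have := abs_sub_abs_le_abs_sub (∫ x, f (T^[m] x) * g x ∂μ)
      (ε2 * ∑ z ∈ Finset.range (levelCount h₁ r' (j + 2)), f (T^[z + m] x₀) * g (T^[z] x₀))
    rw [abs_mul, abs_of_nonneg hε2] at this
    linarith
  rw [stageError]
  refine habs.trans ?_
  change _ + _ + ε2 * |∑ z ∈ Finset.range (levelCount h₁ r' (j + 1 + 1)), Φ (z + m) * Γ z| ≤ _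
  linarith

end IsRankOneTower

end Stage

/-! ### Power sums in `L²` -/

section Isometry

variable {V : Type*} [NormedAddCommGroup V]

theorem norm_sum_shift_sub_le {x : ℕ → V} {B : ℝ} (hx : ∀ i, ‖x i‖ ≤ B) (L n : ℕ) :
    ‖∑ i ∈ Finset.range L, x (n + i) - ∑ i ∈ Finset.range L, x i‖ ≤ 2 * n * B := by
  have h1 := Finset.sum_range_add x n L
  have h2 := Finset.sum_range_add x L n
  rw [add_comm L n, h1] at h2
  have h3 : ∑ i ∈ Finset.range L, x (n + i) - ∑ i ∈ Finset.range L, x i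
      = ∑ i ∈ Finset.range n, x (L + i) - ∑ i ∈ Finset.range n, x i := by
    rw [sub_eq_sub_iff_add_eq_add, add_comm, h2, add_comm]
  rw [h3]
  have hb : ∀ y : ℕ → V, (∀ i, ‖y i‖ ≤ B) → ‖∑ i ∈ Finset.range n, y i‖ ≤ n * B := fun y hy =>
    (norm_sum_le_of_le _ fun i _ => hy i).trans (by simp)
  refine (norm_sub_le _ _).trans ?_
  linarith [hb _ fun i => hx (L + i), hb x hx]

variable [InnerProductSpace ℝ V] (U : V →ₗᵢ[ℝ] V) (F : V)

/-- A long sum along the powers of `U ^ p` is dominated by short sums along the powers of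
`U ^ (p * k)`, because averaging over `N` shifts by multiples of `k` terms changes it by at most
`2 * k * N` terms. -/
theorem natCast_mul_norm_sum_pow_le (p k N L : ℕ) :
    N * ‖∑ i ∈ Finset.range L, (U ^ (p * i)) F‖
      ≤ L * ‖∑ v ∈ Finset.range N, (U ^ (p * k * v)) F‖ + 2 * k * N ^ 2 * ‖F‖ := by
  have hx : ∀ i, ‖(U ^ (p * i)) F‖ ≤ ‖F‖ := fun i => (LinearIsometry.norm_map _ _).le
  have hshift : ∀ v ∈ Finset.range N, ‖∑ i ∈ Finset.range L, (U ^ (p * (k * v + i))) F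
      - ∑ i ∈ Finset.range L, (U ^ (p * i)) F‖ ≤ 2 * (k * N) * ‖F‖ := by
    intro v hv
    refine (norm_sum_shift_sub_le hx L (k * v)).trans ?_
    push_cast
    have : (v : ℝ) ≤ N := by exact_mod_cast (Finset.mem_range.1 hv).le
    gcongr
  have h1 := norm_sum_le_of_le _ hshift
  rw [Finset.sum_sub_distrib, Finset.sum_const, Finset.sum_const, Finset.card_range,
    Finset.sum_comm] at h1
  have h2 : ‖∑ i ∈ Finset.range L, ∑ v ∈ Finset.range N, (U ^ (p * (k * v + i))) F‖
      ≤ L * ‖∑ v ∈ Finset.range N, (U ^ (p * k * v)) F‖ := by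
    refine (norm_sum_le_of_le (n := fun _ => ‖∑ v ∈ Finset.range N, (U ^ (p * k * v)) F‖) _
      fun i _ => le_of_eq ?_).trans (by simp)
    rw [← LinearIsometry.norm_map (U ^ (p * i)) (∑ v ∈ Finset.range N, (U ^ (p * k * v)) F),
      map_sum]
    congr 1
    refine Finset.sum_congr rfl fun v _ => ?_
    rw [← Function.comp_apply (f := ⇑(U ^ (p * i))), ← LinearIsometry.coe_mul, ← pow_add]
    congr 2
    ring
  have h3 : ‖(N : ℕ) • ∑ i ∈ Finset.range L, (U ^ (p * i)) F‖
      = N * ‖∑ i ∈ Finset.range L, (U ^ (p * i)) F‖ := by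
    rw [← Nat.cast_smul_eq_nsmul ℝ, norm_smul, Real.norm_natCast]
  have h4 := norm_sub_norm_le (N • ∑ i ∈ Finset.range L, (U ^ (p * i)) F)
    (∑ i ∈ Finset.range L, ∑ v ∈ Finset.range N, (U ^ (p * (k * v + i))) F)
  rw [norm_sub_rev, h3] at h4
  rw [nsmul_eq_mul] at h1
  nlinarith

/-- Expanding the square: small correlations at the multiples of `q` make sums along the powers of
`U ^ q` small. -/
theorem norm_sum_pow_sq_le (q N : ℕ) {η : ℝ}
    (hη : ∀ d, 1 ≤ d → d < N → |inner ℝ F ((U ^ (q * d)) F)| ≤ η) (hη0 : 0 ≤ η) :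
    ‖∑ v ∈ Finset.range N, (U ^ (q * v)) F‖ ^ 2 ≤ N * ‖F‖ ^ 2 + N ^ 2 * η := by
  have hlt : ∀ v w, w < v → v < N → |inner ℝ ((U ^ (q * w)) F) ((U ^ (q * v)) F)| ≤ η := by
    intro v w hwv hv
    have : (U ^ (q * v)) F = (U ^ (q * w)) ((U ^ (q * (v - w))) F) := by
      rw [← Function.comp_apply (f := ⇑(U ^ (q * w))), ← LinearIsometry.coe_mul, ← pow_add,
        ← mul_add, Nat.add_sub_cancel' hwv.le]
    rw [this, LinearIsometry.inner_map_map]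
    exact hη _ (by omega) (by omega)
  rw [← real_inner_self_eq_norm_sq, sum_inner]
  simp_rw [inner_sum]
  have hterm : ∀ v ∈ Finset.range N, ∀ w ∈ Finset.range N,
      inner ℝ ((U ^ (q * v)) F) ((U ^ (q * w)) F) ≤ (if v = w then ‖F‖ ^ 2 else 0) + η := by
    intro v hv w hw
    rw [Finset.mem_range] at hv hw
    rcases lt_trichotomy v w with hvw | rfl | hvw
    · rw [if_neg hvw.ne, zero_add]
      exact (le_abs_self _).trans (hlt w v hvw hw)
    · rw [if_pos rfl, real_inner_self_eq_norm_sq, LinearIsometry.norm_map]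
      linarith
    · rw [if_neg hvw.ne', zero_add, real_inner_comm]
      exact (le_abs_self _).trans (hlt v w hvw hv)
  refine (Finset.sum_le_sum fun v hv => Finset.sum_le_sum (hterm v hv)).trans (le_of_eq ?_)
  simp only [Finset.sum_add_distrib, Finset.sum_ite_eq, Finset.mem_range, Finset.sum_const,
    Finset.card_range, nsmul_eq_mul]
  rw [Finset.sum_congr rfl fun v hv => if_pos (Finset.mem_range.1 hv)]
  simp
  ring

end Isometry

section Composition

variable {X : Type*} [MeasurableSpace X] {μ : Measure X} {T : X ≃ᵐ X}

theorem compMeasurePreservingₗᵢ_pow_apply (𝕜 : Type*) [RCLike 𝕜] {T : X → X}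
    (hT : MeasurePreserving T μ μ)
    (n : ℕ) (f : Lp 𝕜 2 μ) :
    (Lp.compMeasurePreservingₗᵢ 𝕜 T hT ^ n) f
      = Lp.compMeasurePreserving (T^[n]) (hT.iterate n) f := by
  rw [LinearIsometry.coe_pow, ← Lp.compMeasurePreserving_iterate hT n]
  rfl

theorem coeFn_pow_toLp (hT : MeasurePreserving T μ μ) {f : X → ℝ} (hf : MemLp f 2 μ) (n : ℕ) :
    ((Lp.compMeasurePreservingₗᵢ ℝ T hT ^ n) (hf.toLp f) : X → ℝ) =ᵐ[μ] fun x => f (T^[n] x) := by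
  rw [compMeasurePreservingₗᵢ_pow_apply, Lp.toLp_compMeasurePreserving]
  exact MemLp.coeFn_toLp _

theorem inner_pow_toLp (hT : MeasurePreserving T μ μ) {f : X → ℝ} (hf : MemLp f 2 μ) (n : ℕ) :
    inner ℝ (hf.toLp f) ((Lp.compMeasurePreservingₗᵢ ℝ T hT ^ n) (hf.toLp f))
      = ∫ x, f (T^[n] x) * f x ∂μ := by
  rw [L2.inner_def]
  refine integral_congr_ae ?_
  filter_upwards [coeFn_pow_toLp hT hf n, hf.coeFn_toLp] with x h1 h2
  rw [h1, h2]
  simp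

/-- The mean ergodic theorem for a power of `T` that is ergodic. -/
theorem tendsto_norm_sum_div_of_ergodic (hT : MeasurePreserving T μ μ) {f : X → ℝ}
    (hf : MemLp f 2 μ) (hf0 : ∫ x, f x ∂μ = 0) {p : ℕ} (hp : Ergodic (T^[p]) μ) :
    Tendsto (fun L : ℕ => ‖∑ i ∈ Finset.range L,
      (Lp.compMeasurePreservingₗᵢ ℝ T hT ^ (p * i)) (hf.toLp f)‖ / L) atTop (𝓝 0) := by
  set U := Lp.compMeasurePreservingₗᵢ ℝ T hT (E := ℝ) (p := 2) with hU
  set F := hf.toLp f with hF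
  have hlim := ContinuousLinearMap.tendsto_birkhoffAverage_orthogonalProjection
    ((U ^ p).toContinuousLinearMap) (LinearIsometry.norm_toContinuousLinearMap_le _) F
  have hproj : ((((U ^ p).toContinuousLinearMap).eqLocus
      (1 : Lp ℝ 2 μ →L[ℝ] Lp ℝ 2 μ)).orthogonalProjectionOnto F : Lp ℝ 2 μ) = 0 := by
    rw [ZeroMemClass.coe_eq_zero, Submodule.orthogonalProjectionOnto_eq_zero_iff,
      Submodule.mem_orthogonal]
    intro G hG
    have hG' : (U ^ p) G = G := hG
    rw [hU, compMeasurePreservingₗᵢ_pow_apply] at hG'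
    obtain ⟨c, hc⟩ := hp.eq_const_of_compMeasurePreserving_eq (g := (G : X →ₘ[μ] ℝ))
      (congrArg Subtype.val hG')
    have hGc : (G : X → ℝ) =ᵐ[μ] fun _ => c := by
      rw [hc]; exact AEEqFun.coeFn_const _ _
    rw [L2.inner_def]
    have : ∫ x, inner ℝ (G x) (F x) ∂μ = ∫ x, c * f x ∂μ := by
      refine integral_congr_ae ?_
      filter_upwards [hGc, hf.coeFn_toLp] with x h1 h2
      rw [h1, hF, h2]
      simp [mul_comm]
    rw [this, integral_const_mul, hf0, mul_zero]
  rw [hproj] at hlim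
  have := hlim.norm
  rw [norm_zero] at this
  refine this.congr fun L => ?_
  rw [birkhoffAverage, birkhoffSum, norm_smul, norm_inv, Real.norm_natCast, inv_mul_eq_div]
  congr 2
  refine Finset.sum_congr rfl fun i _ => ?_
  rw [pow_mul, LinearIsometry.coe_pow]
  rfl

variable [IsProbabilityMeasure μ]

theorem memLp_of_abs_le_one {f : X → ℝ} (hf : Measurable f) (hf1 : ∀ x, |f x| ≤ 1) :
    MemLp f 2 μ :=
  MemLp.of_bound hf.aestronglyMeasurable 1 (Eventually.of_forall fun x => hf1 x)

theorem norm_toLp_le_one {f : X → ℝ} (hf : MemLp f 2 μ) (hf1 : ∀ x, |f x| ≤ 1) :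
    ‖hf.toLp f‖ ≤ 1 := by
  rw [Lp.norm_toLp]
  have := eLpNorm_le_of_ae_bound (μ := μ) (p := 2) (f := f) (C := 1)
    (Eventually.of_forall fun x => hf1 x)
  simp only [measure_univ, ENNReal.one_rpow, one_mul, ENNReal.ofReal_one] at this
  exact ENNReal.toReal_le_of_le_ofReal zero_le_one (by simpa using this)

theorem integral_norm_le_norm (G : Lp ℝ 2 μ) : ∫ x, |G x| ∂μ ≤ ‖G‖ := by
  have h1 : ∫ x, |G x| ∂μ = (eLpNorm G 1 μ).toReal := by
    rw [eLpNorm_one_eq_lintegral_enorm, ← integral_norm_eq_lintegral_enorm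
      (Lp.aestronglyMeasurable G)]
    rfl
  rw [h1, Lp.norm_def]
  exact ENNReal.toReal_mono (Lp.eLpNorm_ne_top G)
    (eLpNorm_le_eLpNorm_of_exponent_le (by norm_num) (Lp.aestronglyMeasurable G))

theorem powerSumNorm_le_norm (hT : MeasurePreserving T μ μ) {f : X → ℝ} (hf : MemLp f 2 μ)
    (σ L : ℕ) :
    powerSumNorm μ T f σ L ≤ ‖∑ i ∈ Finset.range L,
      (Lp.compMeasurePreservingₗᵢ ℝ T hT ^ (σ * i)) (hf.toLp f)‖ := by
  refine le_trans (le_of_eq ?_) (integral_norm_le_norm _)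
  refine integral_congr_ae ?_
  have h1 := Lp.coeFn_finsetSum (Finset.range L)
    (fun i => (Lp.compMeasurePreservingₗᵢ ℝ T hT ^ (σ * i)) (hf.toLp f))
  have h2 : ∀ᵐ x ∂μ, ∀ i, ((Lp.compMeasurePreservingₗᵢ ℝ T hT ^ (σ * i)) (hf.toLp f)) x
      = f (T^[σ * i] x) := ae_all_iff.2 fun i => coeFn_pow_toLp hT hf (σ * i)
  filter_upwards [h1, h2] with x h1 h2
  rw [h1, Finset.sum_apply, Finset.sum_congr rfl fun i _ => h2 i]

end Composition

/-! ### Ergodicity -/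

section Sets

variable {X : Type*} [MeasurableSpace X] {μ : Measure X} [IsProbabilityMeasure μ]

theorem abs_measureReal_inter_sub_le (A A' B : Set X) :
    |μ.real (A ∩ B) - μ.real (A' ∩ B)| ≤ μ.real (symmDiff A A') := by
  have key : ∀ A A' : Set X, μ.real (A ∩ B) ≤ μ.real (A' ∩ B) + μ.real (symmDiff A A') := by
    intro A A'
    refine (measureReal_mono ?_).trans (measureReal_union_le _ _)
    intro x hx
    by_cases h : x ∈ A'
    · exact Or.inl ⟨h, hx.2⟩
    · exact Or.inr (Or.inl ⟨hx.1, h⟩)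
  have h1 := key A A'
  have h2 := key A' A
  rw [symmDiff_comm] at h2
  rw [abs_le]
  constructor <;> linarith

theorem abs_measureReal_sub_le (A A' : Set X) :
    |μ.real A - μ.real A'| ≤ μ.real (symmDiff A A') := by
  simpa using abs_measureReal_inter_sub_le (μ := μ) A A' Set.univ

theorem eventuallyConst_of_measureReal_eq_mul_self {A : Set X} (hA : MeasurableSet A)
    (hsq : μ.real A = μ.real A * μ.real A) : EventuallyConst A (ae μ) := by
  rw [eventuallyConst_set']
  have h01 : μ.real A = 0 ∨ μ.real A = 1 := by
    have : μ.real A * (μ.real A - 1) = 0 := by linarith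
    rcases mul_eq_zero.1 this with h | h
    · exact Or.inl h
    · exact Or.inr (by linarith)
  rcases h01 with h0 | h0
  · left
    rw [ae_eq_empty]
    exact (measureReal_eq_zero_iff (measure_ne_top _ _)).1 h0
  · right
    rw [ae_eq_univ]
    refine (measureReal_eq_zero_iff (measure_ne_top _ _)).1 ?_
    rw [probReal_compl_eq_one_sub hA, h0, sub_self]

variable {T : X ≃ᵐ X} {h₁ : ℕ} {r' : ℕ → ℕ} {E : ℕ → Set X} {C : ℕ → ℕ → Set X}

namespace IsRankOneTower

variable (h : IsRankOneTower μ T h₁ (fun j => 2 * r' j) (doubleStair r') E C)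

include h

theorem exists_isLevelUnion {A : Set X} (hA : MeasurableSet A) {ε : ℝ} (hε : 0 < ε) :
    ∃ j B, IsLevelUnion T h₁ r' E j B ∧ μ.real (symmDiff A B) < ε := by
  obtain ⟨j, S, hS, hlt⟩ := h.generating A hA (ENNReal.ofReal ε) (by simpa using hε)
  exact ⟨j, _, ⟨S, fun k hk => Nat.lt_succ_of_le (hS k hk), rfl⟩,
    (ENNReal.lt_ofReal_iff_toReal_lt (measure_ne_top _ _)).1 hlt⟩

variable (hT : MeasurePreserving T μ μ)

include hT

/-- An invariant set has the same measure in each level of a tower. -/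
theorem exists_measureReal_inter_eq_of_invariant {A : Set X} (hA : MeasurableSet A)
    (hinv : T ⁻¹' A = A) {j : ℕ} {B : Set X} (hB : IsLevelUnion T h₁ r' E j B) :
    ∃ n : ℕ, μ.real (A ∩ B) = n * μ.real (A ∩ E j) ∧ μ.real B = n * μ.real (E j) := by
  classical
  obtain ⟨S, hS, rfl⟩ := hB
  have hS' : ∀ k ∈ (Finset.range (levelCount h₁ r' j)).filter (· ∈ S),
      k < levelCount h₁ r' j := fun k hk => by simp at hk; exact hk.1
  have hset : (⋃ k ∈ S, T^[k] '' E j)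
      = ⋃ k ∈ (Finset.range (levelCount h₁ r' j)).filter (· ∈ S), T^[k] '' E j := by
    ext x
    simp only [Set.mem_iUnion, Finset.mem_filter, Finset.mem_range]
    exact ⟨fun ⟨k, hk, hx⟩ => ⟨k, ⟨hS k hk, hk⟩, hx⟩, fun ⟨k, hk, hx⟩ => ⟨k, hk.2, hx⟩⟩
  have hdisj : Set.PairwiseDisjoint
      (↑((Finset.range (levelCount h₁ r' j)).filter (· ∈ S))) (fun k => T^[k] '' E j) :=
    (h.pairwiseDisjoint_levels j).subset fun k hk => by simpa using hS' k (by simpa using hk)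
  have hinvn : ∀ k, T^[k] ⁻¹' A = A := fun k => by
    induction k with
    | zero => rfl
    | succ k ih => rw [Function.iterate_succ', Set.preimage_comp, hinv, ih]
  have hlevel : ∀ k, A ∩ T^[k] '' E j = T^[k] '' (A ∩ E j) := fun k => by
    conv_rhs => rw [← hinvn k, Set.inter_comm, Set.image_inter_preimage]
    exact Set.inter_comm _ _
  refine ⟨((Finset.range (levelCount h₁ r' j)).filter (· ∈ S)).card, ?_, ?_⟩
  · rw [hset, Set.inter_iUnion₂, measureReal_biUnion_finset
      (hdisj.mono fun k => Set.inter_subset_right)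
      fun k _ => hA.inter (h.measurableSet_level j k)]
    simp_rw [hlevel, measureReal_image_iterate hT]
    simp
  · rw [hset, measureReal_biUnion_finset hdisj fun k _ => h.measurableSet_level j k]
    simp_rw [measureReal_image_iterate hT]
    simp

/-- An invariant set is independent of every union of levels, hence of itself. -/
theorem ergodic (hr : ∀ j, 1 ≤ r' j) : Ergodic T μ := by
  refine ⟨hT, ⟨fun A hA hinv => ?_⟩⟩
  have hlim1 := h.tendsto_measureReal_towerSet hT hr
  have hlim2 : Tendsto (fun k => μ.real (A ∩ towerSet T h₁ r' E k)) atTop (𝓝 (μ.real A)) := by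
    refine tendsto_of_tendsto_of_dist tendsto_const_nhds (squeeze_zero (fun _ => dist_nonneg)
      (fun k => ?_) (by simpa using hlim1.const_sub 1))
    have hle : μ.real A ≤ μ.real (A ∩ towerSet T h₁ r' E k)
        + μ.real (towerSet T h₁ r' E k)ᶜ := by
      refine (measureReal_mono ?_).trans (measureReal_union_le _ _)
      intro x hx
      by_cases hx' : x ∈ towerSet T h₁ r' E k
      · exact Or.inl ⟨hx, hx'⟩
      · exact Or.inr hx'
    rw [probReal_compl_eq_one_sub (h.measurableSet_towerSet k)] at hle
    have hge : μ.real (A ∩ towerSet T h₁ r' E k) ≤ μ.real A :=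
      measureReal_mono Set.inter_subset_left
    rw [Real.dist_eq, abs_of_nonneg (by linarith)]
    linarith
  have hindep : ∀ j B, IsLevelUnion T h₁ r' E j B → μ.real (A ∩ B) = μ.real B * μ.real A := by
    intro j B hB
    have heq : ∀ᶠ k in atTop, μ.real (A ∩ B) * μ.real (towerSet T h₁ r' E k)
        = μ.real B * μ.real (A ∩ towerSet T h₁ r' E k) := by
      filter_upwards [eventually_ge_atTop j] with k hk
      obtain ⟨n, hn1, hn2⟩ := h.exists_measureReal_inter_eq_of_invariant hT hA hinv
        (h.isLevelUnion_of_le hr hk hB)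
      obtain ⟨n', hn1', hn2'⟩ := h.exists_measureReal_inter_eq_of_invariant hT hA hinv
        (j := k) (B := towerSet T h₁ r' E k)
        ⟨Set.Iio (levelCount h₁ r' k), fun _ hk => hk, by simp [towerSet]⟩
      rw [hn1, hn2, hn1', hn2']
      ring
    have := tendsto_nhds_unique ((hlim1.const_mul _).congr' heq) (hlim2.const_mul _)
    rwa [mul_one] at this
  have hsq : μ.real A = μ.real A * μ.real A := by
    refine eq_of_forall_dist_le fun ε hε => ?_
    obtain ⟨j, B, hB, hAB⟩ := h.exists_isLevelUnion hA (half_pos hε)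
    have hBm := h.measurableSet_of_isLevelUnion hB
    have h1 := abs_measureReal_inter_sub_le (μ := μ) A B A
    have h2 := abs_measureReal_sub_le (μ := μ) A B
    rw [Set.inter_self, Set.inter_comm, hindep j B hB] at h1
    have h3 : |μ.real B * μ.real A - μ.real A * μ.real A| ≤ μ.real (symmDiff A B) := by
      rw [← sub_mul, abs_mul, abs_sub_comm, abs_of_nonneg (measureReal_nonneg (s := A))]
      exact (mul_le_of_le_one_right (abs_nonneg _) measureReal_le_one).trans h2
    rw [Real.dist_eq]
    have := abs_sub_le (μ.real A) (μ.real B * μ.real A) (μ.real A * μ.real A)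
    linarith
  exact eventuallyConst_of_measureReal_eq_mul_self hA hsq

/-- Mixing for functions that are constant on levels implies mixing for all measurable sets, since
the unions of levels approximate them. -/
theorem tendsto_measureReal_of_levelFun (hr : ∀ j, 1 ≤ r' j) {n : ℕ → ℕ}
    (hn : ∀ j (f g : X → ℝ), (∀ k ≥ j, IsLevelFun T h₁ r' E k f) →
      (∀ k ≥ j, IsLevelFun T h₁ r' E k g) → ∫ x, f x ∂μ = 0 →
      Tendsto (fun i => ∫ x, f (T^[n i] x) * g x ∂μ) atTop (𝓝 0))
    {A B : Set X} (hA : MeasurableSet A) (hB : MeasurableSet B) :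
    Tendsto (fun i => μ.real (T^[n i] ⁻¹' A ∩ B)) atTop (𝓝 (μ.real A * μ.real B)) := by
  have hpre : ∀ i {A : Set X}, MeasurableSet A → MeasurableSet (T^[n i] ⁻¹' A) :=
    fun i A hA => T.measurable.iterate _ hA
  have hlevel : ∀ j A B, IsLevelUnion T h₁ r' E j A → IsLevelUnion T h₁ r' E j B →
      Tendsto (fun i => μ.real (T^[n i] ⁻¹' A ∩ B)) atTop (𝓝 (μ.real A * μ.real B)) := by
    intro j A B hA hB
    have hAm := h.measurableSet_of_isLevelUnion hA
    have hBm := h.measurableSet_of_isLevelUnion hB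
    have hlim := hn j (fun x => A.indicator (fun _ => (1 : ℝ)) x - μ.real A)
      (fun x => B.indicator (fun _ => (1 : ℝ)) x - 0)
      (fun k hk => h.isLevelFun_indicator_sub (h.isLevelUnion_of_le hr hk hA) measureReal_nonneg
        measureReal_le_one)
      (fun k hk => h.isLevelFun_indicator_sub (h.isLevelUnion_of_le hr hk hB) le_rfl zero_le_one)
      (by
        rw [integral_sub ((integrable_const _).indicator hAm) (integrable_const _),
          integral_indicator hAm]
        simp)
    have := hlim.add_const (μ.real A * μ.real B)
    rw [zero_add] at this
    refine this.congr fun i => ?_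
    have heq : ∀ x, (A.indicator (fun _ => (1 : ℝ)) (T^[n i] x) - μ.real A)
        * (B.indicator (fun _ => (1 : ℝ)) x - 0)
        = (T^[n i] ⁻¹' A ∩ B).indicator (fun _ => (1 : ℝ)) x
          - μ.real A * B.indicator (fun _ => (1 : ℝ)) x := by
      intro x
      by_cases hx : T^[n i] x ∈ A <;> by_cases hx' : x ∈ B <;> simp [hx, hx']
    simp_rw [heq]
    have hm := (hpre i hAm).inter hBm
    rw [integral_sub ((integrable_const _).indicator hm)
      (((integrable_const _).indicator hBm).const_mul _), integral_const_mul,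
      integral_indicator hm, integral_indicator hBm]
    simp
  rw [Metric.tendsto_atTop]
  intro ε hε
  obtain ⟨j, A', hA', hAA'⟩ := h.exists_isLevelUnion hA (show 0 < ε / 5 by linarith)
  obtain ⟨j', B', hB', hBB'⟩ := h.exists_isLevelUnion hB (show 0 < ε / 5 by linarith)
  have hAm := h.measurableSet_of_isLevelUnion hA'
  have hBm := h.measurableSet_of_isLevelUnion hB'
  obtain ⟨N, hN⟩ := Metric.tendsto_atTop.1 (hlevel (max j j') A' B'
    (h.isLevelUnion_of_le hr (le_max_left _ _) hA')
    (h.isLevelUnion_of_le hr (le_max_right _ _) hB')) (ε / 5) (by linarith)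
  refine ⟨N, fun i hi => ?_⟩
  have h0 := hN i hi
  rw [Real.dist_eq] at h0 ⊢
  have h1 := abs_measureReal_inter_sub_le (μ := μ) (T^[n i] ⁻¹' A) (T^[n i] ⁻¹' A') B
  have h1' : μ.real (symmDiff (T^[n i] ⁻¹' A) (T^[n i] ⁻¹' A')) = μ.real (symmDiff A A') := by
    rw [← Set.preimage_symmDiff]
    exact (hT.iterate (n i)).measureReal_preimage (hA.symmDiff hAm).nullMeasurableSet
  rw [h1'] at h1
  have h2 := abs_measureReal_inter_sub_le (μ := μ) B B' (T^[n i] ⁻¹' A')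
  rw [Set.inter_comm B, Set.inter_comm B'] at h2
  have h3 := abs_measureReal_sub_le (μ := μ) A A'
  have h4 := abs_measureReal_sub_le (μ := μ) B B'
  have h5 : |μ.real A' * μ.real B' - μ.real A * μ.real B|
      ≤ μ.real (symmDiff A A') + μ.real (symmDiff B B') := by
    have e : μ.real A' * μ.real B' - μ.real A * μ.real B
        = (μ.real A' - μ.real A) * μ.real B' + μ.real A * (μ.real B' - μ.real B) := by ring
    rw [e]
    refine (abs_add_le _ _).trans (add_le_add ?_ ?_)
    · rw [abs_mul, abs_sub_comm, abs_of_nonneg (measureReal_nonneg (s := B'))]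
      exact (mul_le_of_le_one_right (abs_nonneg _) measureReal_le_one).trans h3
    · rw [abs_mul, abs_sub_comm, abs_of_nonneg (measureReal_nonneg (s := A))]
      exact (mul_le_of_le_one_left (abs_nonneg _) measureReal_le_one).trans h4
  rw [abs_lt]
  rw [abs_le] at h1 h2 h5
  rw [abs_lt] at h0
  constructor <;> linarith [h0.1, h0.2, h1.1, h1.2, h2.1, h2.2, h5.1, h5.2]

end IsRankOneTower

end Sets

/-! ### Mixing of functions constant on levels -/

section Mixing

variable {X : Type*} [MeasurableSpace X] {μ : Measure X} [IsProbabilityMeasure μ]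
  {T : X ≃ᵐ X} {h₁ : ℕ} {r' : ℕ → ℕ} {E : ℕ → Set X} {C : ℕ → ℕ → Set X}

theorem strictMono_levelCount (hr : ∀ j, 1 ≤ r' j) : StrictMono (levelCount h₁ r') :=
  strictMono_nat_of_lt_succ fun j => by
    rw [levelCount_succ hr, columnStart_eq]
    have h1 : 2 * levelCount h₁ r' j ≤ 2 * r' j * levelCount h₁ r' j :=
      Nat.mul_le_mul_right _ (by have := hr j; omega)
    have := levelCount_pos (h₁ := h₁) (r' := r') j
    omega

theorem exists_levelCount_le_lt (hr : ∀ j, 1 ≤ r' j) {t m : ℕ} (hm : levelCount h₁ r' t ≤ m) :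
    ∃ j ≥ t, levelCount h₁ r' j ≤ m ∧ m < levelCount h₁ r' (j + 1) := by
  have hex : ∃ j, m < levelCount h₁ r' (t + j) := ⟨m, by
    have := succ_le_levelCount (h₁ := h₁) hr (t + m)
    omega⟩
  classical
  have hpos : Nat.find hex ≠ 0 := fun h0 => by
    have := Nat.find_spec hex
    rw [h0, add_zero] at this
    omega
  refine ⟨t + (Nat.find hex - 1), by omega, ?_, ?_⟩
  · exact not_lt.1 (Nat.find_min hex (m := Nat.find hex - 1) (by omega))
  · have := Nat.find_spec hex
    rwa [add_assoc, Nat.sub_add_cancel (by omega)]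

theorem eventually_mul_sq_le_levelCount (hr : ∀ j, 1 ≤ r' j)
    (hr_adams : Tendsto (fun j => ((2 * r' j : ℕ) : ℝ) ^ 2 / (dsHeight h₁ r' j : ℝ)) atTop (𝓝 0))
    (c : ℝ) (hc : 0 < c) : ∀ᶠ j in atTop, c * (r' j : ℝ) ^ 2 ≤ levelCount h₁ r' j := by
  filter_upwards [(tendsto_sq_div_levelCount hr hr_adams).eventually
    (gt_mem_nhds (show (0 : ℝ) < 1 / c by positivity))] with j hj
  have hpos : (0 : ℝ) < levelCount h₁ r' j := by exact_mod_cast levelCount_pos j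
  rw [div_lt_div_iff₀ hpos hc] at hj
  linarith

/-- `W c L = o(L)` as `L → ∞`, uniformly in `1 ≤ c ≤ A`. -/
def SublinearUpTo (W : ℕ → ℕ → ℝ) (A : ℕ) : Prop :=
  ∀ ε > 0, ∃ R : ℝ, 0 ≤ R ∧ ∀ c, 1 ≤ c → c ≤ A → ∀ L : ℕ, W c L ≤ ε * L + R

theorem sublinearUpTo_of_tendsto {W : ℕ → ℕ → ℝ} {A : ℕ} (hWL : ∀ c L, W c L ≤ L)
    (hW : ∀ c, 1 ≤ c → c ≤ A → Tendsto (fun L : ℕ => W c L / L) atTop (𝓝 0)) :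
    SublinearUpTo W A := by
  intro ε hε
  have hex : ∀ c, ∃ R : ℕ, 1 ≤ c → c ≤ A → ∀ L : ℕ, W c L ≤ ε * L + R := by
    intro c
    by_cases hc : 1 ≤ c ∧ c ≤ A
    · obtain ⟨R, hR⟩ := eventually_atTop.1 ((hW c hc.1 hc.2).eventually (gt_mem_nhds hε))
      refine ⟨R, fun _ _ L => ?_⟩
      rcases le_total R L with hL | hL
      · rcases Nat.eq_zero_or_pos L with rfl | hL0
        · have := hWL c 0
          push_cast at this ⊢
          have : (0 : ℝ) ≤ R := Nat.cast_nonneg R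
          linarith
        · have h1 := hR L hL
          have hL0' : (0 : ℝ) < L := by exact_mod_cast hL0
          rw [div_lt_iff₀ hL0'] at h1
          have : (0 : ℝ) ≤ R := Nat.cast_nonneg R
          linarith
      · have h1 := hWL c L
        have : (L : ℝ) ≤ R := by exact_mod_cast hL
        have : 0 ≤ ε * L := by positivity
        linarith
    · exact ⟨0, fun h1 h2 => absurd ⟨h1, h2⟩ hc⟩
  choose R hR using hex
  refine ⟨∑ c ∈ Finset.range (A + 1), (R c : ℝ), by positivity, fun c hc1 hcA L => ?_⟩
  have h1 : (R c : ℝ) ≤ ∑ c ∈ Finset.range (A + 1), (R c : ℝ) :=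
    Finset.single_le_sum (f := fun c => (R c : ℝ)) (fun _ _ => Nat.cast_nonneg _)
      (Finset.mem_range.2 (by omega))
  linarith [hR c hc1 hcA L]

theorem shiftNorm_le_of_sublinear {f : X → ℝ} (hf1 : ∀ x, |f x| ≤ 1) {A : ℕ} {ε R : ℝ}
    (hR : ∀ c, 1 ≤ c → c ≤ A → ∀ L : ℕ, powerSumNorm μ T f c L ≤ ε * L + R) (hε : 0 ≤ ε)
    {ρ c : ℕ} (hc1 : 1 ≤ c) (hcA : c ≤ A) :
    shiftNorm μ T f ρ c ≤ 2 * ε * ρ + 2 * R + A := by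
  have h1 := hR c hc1 hcA (ρ - c)
  have h2 := powerSumNorm_le (μ := μ) (T := T) hf1 ((c - ρ) + (ρ - c)) (min c (2 * ρ - c))
  have h3 : ((min c (2 * ρ - c) : ℕ) : ℝ) ≤ A := by
    exact_mod_cast (min_le_left _ _).trans hcA
  have h4 : ((ρ - c : ℕ) : ℝ) ≤ ρ := by exact_mod_cast Nat.sub_le _ _
  have h5 := mul_le_mul_of_nonneg_left h4 hε
  rw [shiftNorm]
  linarith

theorem tendsto_powerSumNorm_div (hT : MeasurePreserving T μ μ) {f : X → ℝ}
    (hfm : Measurable f) (hf1 : ∀ x, |f x| ≤ 1) (hf0 : ∫ x, f x ∂μ = 0) {p : ℕ}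
    (hp : Ergodic (T^[p]) μ) :
    Tendsto (fun L : ℕ => powerSumNorm μ T f p L / L) atTop (𝓝 0) :=
  squeeze_zero (fun L => div_nonneg (powerSumNorm_nonneg f p L) (Nat.cast_nonneg L))
    (fun L => div_le_div_of_nonneg_right
      (powerSumNorm_le_norm hT (memLp_of_abs_le_one hfm hf1) p L) (Nat.cast_nonneg L))
    (tendsto_norm_sum_div_of_ergodic hT (memLp_of_abs_le_one hfm hf1) hf0 hp)

namespace IsRankOneTower

variable (h : IsRankOneTower μ T h₁ (fun j => 2 * r' j) (doubleStair r') E C)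
  (hT : MeasurePreserving T μ μ)

include h hT

/-- Mixing along times that are bounded multiples of the heights, when the power sums with bounded
slopes grow sublinearly. The slope `a + 1` is needed only if `b` exceeds the number of spacers. -/
theorem eventually_abs_integral_le_of_sublinear (hr : ∀ j, 1 ≤ r' j)
    (hr_top : Tendsto r' atTop atTop)
    (hr_adams : Tendsto (fun j => ((2 * r' j : ℕ) : ℝ) ^ 2 / (dsHeight h₁ r' j : ℝ)) atTop (𝓝 0))
    {j₀ : ℕ} {f g : X → ℝ} (hf : ∀ k ≥ j₀, IsLevelFun T h₁ r' E k f)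
    (hg : ∀ k ≥ j₀, IsLevelFun T h₁ r' E k g) {A : ℕ} (hA : 1 ≤ A)
    (hW : SublinearUpTo (powerSumNorm μ T f) A) {ε : ℝ} (hε : 0 < ε) :
    ∀ᶠ t in atTop, ∀ a b, 1 ≤ a → a ≤ A → b < levelCount h₁ r' t →
      (b ≤ r' t * r' t ∨ a + 1 ≤ A) →
      |∫ x, f (T^[a * levelCount h₁ r' t + b] x) * g x ∂μ| ≤ ε := by
  obtain ⟨R, hR0, hR⟩ := hW (ε / 8) (by linarith)
  have hf1 : ∀ x, |f x| ≤ 1 := (hf j₀ le_rfl).abs_le_one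
  have hcast : Tendsto (fun t => (r' t : ℝ)) atTop atTop :=
    tendsto_natCast_atTop_atTop.comp hr_top
  have hcast' : Tendsto (fun t => (r' (t + 1) : ℝ)) atTop atTop :=
    (tendsto_add_atTop_iff_nat 1).2 hcast
  filter_upwards [eventually_ge_atTop j₀, hr_top.eventually_ge_atTop (A + 1),
    (h.tendsto_stageError hT hr hr_top hr_adams).eventually
      (gt_mem_nhds (show (0 : ℝ) < ε / 4 by linarith)),
    (hcast.const_div_atTop (2 * R + A)).eventually
      (gt_mem_nhds (show (0 : ℝ) < ε / 8 by linarith)),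
    (hcast'.const_div_atTop R).eventually
      (gt_mem_nhds (show (0 : ℝ) < ε / 8 by linarith))]
    with t ht hρA herr hρ hρ' a b ha haA hb hcase
  have hρ0 : (0 : ℝ) < r' t := by exact_mod_cast hr t
  have hρ0' : (0 : ℝ) < r' (t + 1) := by exact_mod_cast hr (t + 1)
  have hmK : a * levelCount h₁ r' t + b < levelCount h₁ r' (t + 1) := by
    rw [levelCount_succ hr, columnStart_eq]
    have : (a + 1) * levelCount h₁ r' t ≤ 2 * r' t * levelCount h₁ r' t :=
      Nat.mul_le_mul_right _ (by omega)
    rw [add_mul] at this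
    omega
  have hmain := h.abs_integral_le hT hr (fun k hk => hf k (ht.trans hk))
    (fun k hk => hg k (ht.trans hk)) rfl hb hmK
  have hs1 := shiftNorm_le_of_sublinear hf1 hR (by linarith) (ρ := r' t) ha haA
  have hs2 : (if b ≤ r' t * r' t then 0 else shiftNorm μ T f (r' t) (a + 1))
      ≤ 2 * (ε / 8) * r' t + 2 * R + A := by
    split_ifs with hb'
    · positivity
    · exact shiftNorm_le_of_sublinear hf1 hR (by linarith) (by omega)
        (hcase.resolve_left hb')
  have hin : 1 / (2 * r' t : ℝ) * (shiftNorm μ T f (r' t) a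
      + if b ≤ r' t * r' t then 0 else shiftNorm μ T f (r' t) (a + 1))
      ≤ 2 * (ε / 8) + (2 * R + A) / r' t := by
    have : 2 * (ε / 8) + (2 * R + A) / r' t
        = 1 / (2 * r' t : ℝ) * (2 * (2 * (ε / 8) * r' t + 2 * R + A)) := by
      field_simp
      ring
    rw [this]
    exact mul_le_mul_of_nonneg_left (by linarith) (by positivity)
  have hex : 1 / (r' (t + 1) : ℝ) * powerSumNorm μ T f 1 (r' (t + 1) - 1)
      ≤ ε / 8 + R / r' (t + 1) := by
    have : ε / 8 + R / r' (t + 1) = 1 / (r' (t + 1) : ℝ) * (ε / 8 * r' (t + 1) + R) := by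
      field_simp
    rw [this]
    refine mul_le_mul_of_nonneg_left ((hR 1 le_rfl hA _).trans ?_) (by positivity)
    have : ((r' (t + 1) - 1 : ℕ) : ℝ) ≤ r' (t + 1) := by exact_mod_cast Nat.sub_le _ _
    gcongr
  linarith

/-- Every power of `T` is ergodic: for a set that is invariant under `T ^ p`, mixing along the
multiples of `p` next to the heights shows that the set is independent of itself. -/
theorem ergodic_iterate (hr : ∀ j, 1 ≤ r' j) (hr_top : Tendsto r' atTop atTop)
    (hr_adams : Tendsto (fun j => ((2 * r' j : ℕ) : ℝ) ^ 2 / (dsHeight h₁ r' j : ℝ)) atTop (𝓝 0))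
    {p : ℕ} (hp : 1 ≤ p) : Ergodic (T^[p]) μ := by
  -- a multiple of `p` in `[H t, H t + p)`
  set c : ℕ → ℕ := fun t => (levelCount h₁ r' t + p - 1) / p * p - levelCount h₁ r' t with hc
  have hdiv : ∀ t, levelCount h₁ r' t ≤ (levelCount h₁ r' t + p - 1) / p * p ∧
      (levelCount h₁ r' t + p - 1) / p * p < levelCount h₁ r' t + p := by
    intro t
    have h1 := Nat.div_add_mod (levelCount h₁ r' t + p - 1) p
    have h2 := Nat.mod_lt (levelCount h₁ r' t + p - 1) hp
    rw [mul_comm] at h1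
    omega
  have hmul : ∀ t, 1 * levelCount h₁ r' t + c t = (levelCount h₁ r' t + p - 1) / p * p :=
    fun t => by have := hdiv t; simp only [hc]; omega
  have hmix := fun {A B : Set X} (hA : MeasurableSet A) (hB : MeasurableSet B) =>
    h.tendsto_measureReal_of_levelFun hT hr (n := fun t => 1 * levelCount h₁ r' t + c t)
      (fun j f g hf hg hf0 => by
        have hf1 := (hf j le_rfl).abs_le_one
        have hW : SublinearUpTo (powerSumNorm μ T f) 1 :=
          sublinearUpTo_of_tendsto (fun c L => powerSumNorm_le hf1 c L) fun c h1 h2 => by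
            obtain rfl : c = 1 := by omega
            exact tendsto_powerSumNorm_div hT (hf j le_rfl).measurable hf1 hf0
              (by simpa using h.ergodic hT hr)
        rw [Metric.tendsto_atTop]
        intro ε hε
        have hev := h.eventually_abs_integral_le_of_sublinear hT hr hr_top hr_adams hf hg le_rfl
          hW (half_pos hε)
        obtain ⟨N, hN⟩ := eventually_atTop.1 (hev.and ((hr_top.eventually_ge_atTop p).and
          (eventually_ge_atTop p)))
        refine ⟨N, fun t ht => ?_⟩
        obtain ⟨h1, h2, h3⟩ := hN t ht
        have h4 := hdiv t
        have h5 : c t < p := by simp only [hc]; omega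
        have h6 := succ_le_levelCount (h₁ := h₁) hr t
        have h7 : r' t ≤ r' t * r' t := Nat.le_mul_self _
        rw [dist_zero_right, Real.norm_eq_abs]
        exact (h1 1 (c t) le_rfl le_rfl (by omega) (Or.inl (by omega))).trans_lt (by linarith))
      hA hB
  refine ⟨hT.iterate p, ⟨fun A hA hinv => ?_⟩⟩
  have hinvn : ∀ t, T^[1 * levelCount h₁ r' t + c t] ⁻¹' A = A := fun t => by
    rw [hmul t, mul_comm, Function.iterate_mul]
    generalize (levelCount h₁ r' t + p - 1) / p = n
    induction n with
    | zero => rfl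
    | succ n ih => rw [Function.iterate_succ', Set.preimage_comp, hinv, ih]
  have hlim := hmix hA hA
  simp_rw [hinvn, Set.inter_self] at hlim
  have hsq := tendsto_nhds_unique hlim tendsto_const_nhds
  exact eventuallyConst_of_measureReal_eq_mul_self hA hsq.symm

/-- Adams' uniform bound for power sums with slopes up to the number of columns. -/
theorem exists_powerSumNorm_le (hr : ∀ j, 1 ≤ r' j) (hr_top : Tendsto r' atTop atTop)
    (hr_adams : Tendsto (fun j => ((2 * r' j : ℕ) : ℝ) ^ 2 / (dsHeight h₁ r' j : ℝ)) atTop (𝓝 0))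
    {j₀ : ℕ} {f : X → ℝ} (hf : ∀ k ≥ j₀, IsLevelFun T h₁ r' E k f) (hf0 : ∫ x, f x ∂μ = 0)
    {ε : ℝ} (hε : 0 < ε) :
    ∃ R₀ : ℕ, ∀ ρ ≥ R₀, ∀ σ L, 1 ≤ σ → σ ≤ ρ → L ≤ ρ → powerSumNorm μ T f σ L ≤ ε * ρ := by
  have hfm := (hf j₀ le_rfl).measurable
  have hf1 := (hf j₀ le_rfl).abs_le_one
  have hsub : ∀ A, SublinearUpTo (powerSumNorm μ T f) A := fun A =>
    sublinearUpTo_of_tendsto (fun c L => powerSumNorm_le hf1 c L) fun c hc _ =>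
      tendsto_powerSumNorm_div hT hfm hf1 hf0 (h.ergodic_iterate hT hr hr_top hr_adams hc)
  have hLp : MemLp f 2 μ := memLp_of_abs_le_one hfm hf1
  set U := Lp.compMeasurePreservingₗᵢ ℝ T hT (E := ℝ) (p := 2) with hU
  set F := hLp.toLp f with hF
  have hFle : ‖F‖ ≤ 1 := norm_toLp_le_one hLp hf1
  -- `N` is so large that `N + N ^ 2 * (1 / N) ≤ (N * (ε / 2)) ^ 2` in `norm_sum_pow_sq_le`
  obtain ⟨N, hN⟩ := exists_nat_gt (8 / ε ^ 2)
  have hN0 : (0 : ℝ) < N := lt_trans (by positivity) hN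
  have hN1 : 1 ≤ N := by exact_mod_cast hN0
  have hNε : 8 < N * ε ^ 2 := by rwa [div_lt_iff₀ (by positivity)] at hN
  obtain ⟨t₀, ht₀⟩ := eventually_atTop.1
    ((h.eventually_abs_integral_le_of_sublinear hT hr hr_top hr_adams hf hf
      (A := 2 * N + 1) (by omega) (hsub _) (one_div_pos.2 hN0)).and
    ((eventually_mul_sq_le_levelCount hr hr_adams (16 * N / ε) (by positivity)).and
      (eventually_mul_sq_le_levelCount hr hr_adams 1 one_pos)))
  obtain ⟨R, hR0, hR⟩ := hsub (levelCount h₁ r' t₀) (ε / 2) (by linarith)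
  obtain ⟨R₀, hR₀⟩ := exists_nat_gt (2 * R / ε)
  refine ⟨R₀, fun ρ hρ p L hp hpρ hLρ => ?_⟩
  have hLρ' : (L : ℝ) ≤ ρ := by exact_mod_cast hLρ
  rcases le_total p (levelCount h₁ r' t₀) with hpt | hpt
  · have h1 := hR p hp hpt L
    have h2 : (R₀ : ℝ) ≤ ρ := by exact_mod_cast hρ
    rw [div_lt_iff₀ hε] at hR₀
    nlinarith
  obtain ⟨t, ht, htp, hpt'⟩ := exists_levelCount_le_lt hr hpt
  set H := levelCount h₁ r' t with hH
  set K := levelCount h₁ r' (t + 1) with hK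
  -- `k * p` is the first multiple of `p` that is at least `K`
  obtain ⟨k, hk1, hk2⟩ : ∃ k, K ≤ k * p ∧ k * p < K + p := by
    refine ⟨(K + p - 1) / p, ?_⟩
    have h1 := Nat.div_add_mod (K + p - 1) p
    have h2 := Nat.mod_lt (K + p - 1) hp
    rw [mul_comm] at h1
    omega
  have hsq : r' t * r' t ≤ H := by
    have := (ht₀ t ht).2.2
    rw [one_mul, sq] at this
    exact_mod_cast this
  have hk : k ≤ 4 * r' t := by
    have h1 : K ≤ (2 * r' t + 1) * p := by
      rw [hK, levelCount_succ hr, columnStart_eq, ← hH, add_mul, one_mul]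
      have h2 := stairSum_le (r' t) (2 * r' t) le_rfl
      have h3 : 2 * r' t * H ≤ 2 * r' t * p := Nat.mul_le_mul_left _ htp
      omega
    have h2 : k * p < (2 * r' t + 2) * p := by
      have : (2 * r' t + 2) * p = (2 * r' t + 1) * p + p := by ring
      omega
    have := lt_of_mul_lt_mul_right h2 (Nat.zero_le p)
    have := hr t
    omega
  have hcorr : ∀ d, 1 ≤ d → d < N → |inner ℝ F ((U ^ (p * k * d)) F)| ≤ 1 / N := by
    intro d hd hdN
    rw [hF, hU, inner_pow_toLp]
    have hKpos : 0 < K := levelCount_pos _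
    have h1 := (ht₀ (t + 1) (by omega)).1 (p * k * d / K) (p * k * d % K) ?_ ?_
      (Nat.mod_lt _ hKpos) (Or.inr ?_)
    · rwa [← hK, Nat.div_add_mod'] at h1
    · rw [Nat.le_div_iff_mul_le hKpos, one_mul]
      calc K ≤ p * k := by rw [mul_comm]; exact hk1
        _ ≤ p * k * d := Nat.le_mul_of_pos_right _ hd
    all_goals
      have h2 : p * k * d / K < 2 * N := by
        rw [Nat.div_lt_iff_lt_mul hKpos]
        have h3 : p * k ≤ 2 * K := by rw [mul_comm]; omega
        calc p * k * d ≤ 2 * K * d := Nat.mul_le_mul_right _ h3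
          _ < 2 * K * N := Nat.mul_lt_mul_of_pos_left hdN (by omega)
          _ = 2 * N * K := by ring
      omega
  have hsum := norm_sum_pow_sq_le U F (p * k) N hcorr (by positivity)
  have hblock : ‖∑ v ∈ Finset.range N, (U ^ (p * k * v)) F‖ ≤ N * (ε / 2) := by
    refine abs_le_of_sq_le_sq' ?_ (by positivity) |>.2
    refine hsum.trans ?_
    have h1 : ‖F‖ ^ 2 ≤ 1 := pow_le_one₀ (norm_nonneg _) hFle
    have h2 : (N : ℝ) ^ 2 * (1 / N) = N := by field_simp
    rw [h2]
    nlinarith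
  have havg := natCast_mul_norm_sum_pow_le U F p k N L
  have hk' : (k : ℝ) ≤ 4 * r' t := by exact_mod_cast hk
  have hρ16 : 16 * N * (r' t : ℝ) ≤ ε * ρ := by
    have h1 := (ht₀ t ht).2.1
    rw [div_mul_eq_mul_div, div_le_iff₀ hε] at h1
    have h2 : (H : ℝ) ≤ ρ := by exact_mod_cast htp.trans hpρ
    have h3 : (1 : ℝ) ≤ r' t := by exact_mod_cast hr t
    have h4 : (r' t : ℝ) ≤ (r' t : ℝ) ^ 2 := by nlinarith
    have h5 := mul_le_mul_of_nonneg_left h4 (show (0 : ℝ) ≤ 16 * N by positivity)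
    have h6 := mul_le_mul_of_nonneg_left h2 hε.le
    linarith
  refine (powerSumNorm_le_norm hT hLp p L).trans ?_
  rw [← hU, ← hF]
  have h1 : (L : ℝ) * ‖∑ v ∈ Finset.range N, (U ^ (p * k * v)) F‖ ≤ ρ * (N * (ε / 2)) :=
    mul_le_mul hLρ' hblock (norm_nonneg _) (Nat.cast_nonneg _)
  have h2 : 2 * k * (N : ℝ) ^ 2 * ‖F‖ ≤ 2 * (4 * r' t) * N ^ 2 := by
    refine (mul_le_of_le_one_right (by positivity) hFle).trans ?_
    gcongr
  have h3 : N * (16 * N * (r' t : ℝ)) ≤ N * (ε * ρ) := mul_le_mul_of_nonneg_left hρ16 hN0.le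
  refine le_of_mul_le_mul_left ?_ hN0
  linarith

/-- Mixing along `mixingTimes` for functions constant on levels. -/
theorem exists_abs_integral_le_of_mem_mixingTimes (hr : ∀ j, 1 ≤ r' j)
    (hr_top : Tendsto r' atTop atTop)
    (hr_adams : Tendsto (fun j => ((2 * r' j : ℕ) : ℝ) ^ 2 / (dsHeight h₁ r' j : ℝ)) atTop (𝓝 0))
    {j₀ : ℕ} {f g : X → ℝ} (hf : ∀ k ≥ j₀, IsLevelFun T h₁ r' E k f)
    (hg : ∀ k ≥ j₀, IsLevelFun T h₁ r' E k g) (hf0 : ∫ x, f x ∂μ = 0) {ε : ℝ} (hε : 0 < ε) :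
    ∃ N, ∀ m ≥ N, m ∈ mixingTimes h₁ r' → |∫ x, f (T^[m] x) * g x ∂μ| ≤ ε := by
  obtain ⟨R₀, hR₀⟩ := h.exists_powerSumNorm_le hT hr hr_top hr_adams hf hf0
    (show 0 < ε / 8 by linarith)
  have hshift : ∀ ρ ≥ R₀, ∀ c, 1 ≤ c → c ≠ ρ → shiftNorm μ T f ρ c ≤ 3 * (ε / 8) * ρ := by
    intro ρ hρ c hc hcρ
    have hpos : 0 ≤ ε / 8 * ρ := by positivity
    have h1 : powerSumNorm μ T f c (ρ - c) ≤ ε / 8 * ρ := by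
      rcases le_total c ρ with hle | hle
      · exact hR₀ ρ hρ c (ρ - c) hc hle (Nat.sub_le _ _)
      · rw [Nat.sub_eq_zero_of_le hle, powerSumNorm_zero]
        exact hpos
    have h2 : powerSumNorm μ T f ((c - ρ) + (ρ - c)) (min c (2 * ρ - c)) ≤ ε / 8 * ρ := by
      rcases le_total c (2 * ρ) with hle | hle
      · exact hR₀ ρ hρ _ _ (by omega) (by omega) (by omega)
      · have : min c (2 * ρ - c) = 0 := by omega
        rw [this, powerSumNorm_zero]
        exact hpos
    rw [shiftNorm]
    linarith
  have hr_top' : Tendsto (fun j => r' (j + 1)) atTop atTop :=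
    (tendsto_add_atTop_iff_nat 1).2 hr_top
  obtain ⟨t, ht⟩ := eventually_atTop.1 ((eventually_ge_atTop j₀).and
    ((hr_top.eventually_ge_atTop (max R₀ 2)).and ((hr_top'.eventually_ge_atTop (max R₀ 2)).and
    (((h.tendsto_stageError hT hr hr_top hr_adams).eventually
      (gt_mem_nhds (show (0 : ℝ) < ε / 8 by linarith))).and
    (eventually_mul_sq_le_levelCount hr hr_adams 1 one_pos)))))
  refine ⟨levelCount h₁ r' t, fun m hm hmM => ?_⟩
  obtain ⟨j, hj, hjm, hmj⟩ := exists_levelCount_le_lt hr hm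
  obtain ⟨hj₀, hρ, hρ', herr, hsq⟩ := ht j hj
  set H := levelCount h₁ r' j with hH
  set ρ := r' j with hρdef
  have hHpos : 0 < H := levelCount_pos _
  have hsq' : ρ * ρ ≤ H := by
    rw [one_mul, sq] at hsq
    exact_mod_cast hsq
  set a := m / H with ha
  set b := m % H with hb
  have hm_eq : m = a * H + b := (Nat.div_add_mod' m H).symm
  have hbH : b < H := Nat.mod_lt _ hHpos
  have ha1 : 1 ≤ a := by rw [ha, Nat.le_div_iff_mul_le hHpos]; omega
  have hρ2 : 2 ≤ ρ := (le_max_right _ _).trans hρ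
  -- `m` is not within `H` of half the next height
  have hfar : 2 * m + 2 * H + ρ ≤ 2 * (ρ * H) + ρ * ρ ∨
      2 * (ρ * H) + ρ * ρ + 2 * H ≤ 2 * m + ρ + 2 := by
    have hnot : (m : ℝ) ∉ halfInterval h₁ r' j := fun hmem => hmM (Set.mem_iUnion.2 ⟨j, hmem⟩)
    have hKeq : dsHeight h₁ r' (j + 1) + 1 + ρ = 2 * (ρ * H) + ρ * ρ := by
      have h1 := levelCount_succ (h₁ := h₁) hr j
      rw [columnStart_eq, levelCount, ← hH, ← hρdef] at h1
      have h2 := stairSum_two_mul_add ρ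
      rw [mul_assoc] at h1
      omega
    have hHeq : dsHeight h₁ r' j + 1 = H := rfl
    have hKeq' : (dsHeight h₁ r' (j + 1) : ℝ) + 1 + ρ = 2 * (ρ * H) + ρ * ρ := by
      exact_mod_cast hKeq
    have hHeq' : (dsHeight h₁ r' j : ℝ) + 1 = H := by exact_mod_cast hHeq
    rw [halfInterval, Set.mem_Icc, not_and_or, not_le, not_le] at hnot
    rcases hnot with hlt | hlt
    · left
      have : ((2 * m + 2 * H + ρ : ℕ) : ℝ) < ((2 * (ρ * H) + ρ * ρ + 1 : ℕ) : ℝ) := by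
        push_cast; linarith
      have := Nat.cast_lt.1 this
      omega
    · right
      have : ((2 * (ρ * H) + ρ * ρ + 2 * H : ℕ) : ℝ) < ((2 * m + ρ + 3 : ℕ) : ℝ) := by
        push_cast; linarith
      have := Nat.cast_lt.1 this
      omega
  have hρρ : 2 * ρ ≤ ρ * ρ := Nat.mul_le_mul_right _ hρ2
  -- the slope `0` does not occur
  have hslope : a ≠ ρ ∧ (b ≤ ρ * ρ ∨ a + 1 ≠ ρ) := by
    rcases hfar with hlow | hhigh
    · have haρ : a < ρ := by
        by_contra hge
        have := Nat.mul_le_mul_right H (not_lt.1 hge)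
        omega
      refine ⟨haρ.ne, ?_⟩
      by_cases ha' : a + 1 = ρ
      · left
        have : (a + 1) * H = ρ * H := by rw [ha']
        rw [add_mul] at this
        omega
      · exact Or.inr ha'
    · have haρ : ρ < a := by
        by_contra hge
        have := Nat.mul_le_mul_right H (not_lt.1 hge)
        omega
      exact ⟨haρ.ne', Or.inr (by omega)⟩
  have hmain := h.abs_integral_le hT hr (fun k hk => hf k (hj₀.trans hk))
    (fun k hk => hg k (hj₀.trans hk)) hm_eq hbH hmj
  have hρR : R₀ ≤ ρ := (le_max_left _ _).trans hρ
  have hs1 := hshift ρ hρR a ha1 hslope.1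
  have hs2 : (if b ≤ ρ * ρ then 0 else shiftNorm μ T f ρ (a + 1)) ≤ 3 * (ε / 8) * ρ := by
    split_ifs with hb'
    · positivity
    · exact hshift ρ hρR (a + 1) (by omega) (hslope.2.resolve_left hb')
  have hρ0 : (0 : ℝ) < ρ := by exact_mod_cast hr j
  have hρ0' : (0 : ℝ) < r' (j + 1) := by exact_mod_cast hr (j + 1)
  have hin : 1 / (2 * ρ : ℝ) * (shiftNorm μ T f ρ a
      + if b ≤ ρ * ρ then 0 else shiftNorm μ T f ρ (a + 1)) ≤ 3 * (ε / 8) := by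
    have : 3 * (ε / 8) = 1 / (2 * ρ : ℝ) * (2 * (3 * (ε / 8) * ρ)) := by field_simp
    rw [this]
    exact mul_le_mul_of_nonneg_left (by linarith) (by positivity)
  have hex : 1 / (r' (j + 1) : ℝ) * powerSumNorm μ T f 1 (r' (j + 1) - 1) ≤ ε / 8 := by
    have : ε / 8 = 1 / (r' (j + 1) : ℝ) * (ε / 8 * r' (j + 1)) := by field_simp
    rw [this]
    exact mul_le_mul_of_nonneg_left (hR₀ _ ((le_max_left _ _).trans hρ') 1 _ le_rfl (hr _)
      (Nat.sub_le _ _)) (by positivity)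
  linarith

end IsRankOneTower

end Mixing

/-! ### Weak convergence in `L²` -/

section WeakConvergence

variable {X : Type*} [MeasurableSpace X] {μ : Measure X} {T : X ≃ᵐ X} (𝕜 : Type*) [RCLike 𝕜]

theorem koopman_pow_apply (hT : MeasurePreserving T μ μ) (n : ℕ) (f : Lp 𝕜 2 μ) :
    (koopman 𝕜 T hT ^ n) f = Lp.compMeasurePreserving (T^[n]) (hT.iterate n) f := by
  rw [← compMeasurePreservingₗᵢ_pow_apply]
  induction n with
  | zero => rfl
  | succ n ih =>
    rw [pow_succ', pow_succ', LinearIsometryEquiv.coe_mul, LinearIsometry.coe_mul,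
      Function.comp_apply, Function.comp_apply, ih]
    rfl

variable [IsProbabilityMeasure μ]

theorem inner_constProjection (f g : Lp 𝕜 2 μ) :
    inner 𝕜 g (constProjection 𝕜 μ f)
      = inner 𝕜 (Lp.const 2 μ (1 : 𝕜)) f * inner 𝕜 g (Lp.const 2 μ (1 : 𝕜)) := by
  rw [constProjection, Submodule.starProjection_unit_singleton, inner_smul_right]
  rw [Lp.norm_const _ _ _ (by norm_num)]
  simp

theorem inner_constProjection_symm (f g : Lp 𝕜 2 μ) :
    inner 𝕜 g (constProjection 𝕜 μ f) = starRingEnd 𝕜 (inner 𝕜 f (constProjection 𝕜 μ g)) := by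
  rw [inner_constProjection, inner_constProjection, map_mul, inner_conj_symm, inner_conj_symm,
    mul_comm]

variable {𝕜}

theorem isMixingAlong_of_tendsto_measureReal (hT : MeasurePreserving T μ μ) {n : ℕ → ℕ}
    (hn : ∀ A B : Set X, MeasurableSet A → MeasurableSet B →
      Tendsto (fun i => μ.real (T^[n i] ⁻¹' A ∩ B)) atTop (𝓝 (μ.real A * μ.real B))) :
    IsMixingAlong 𝕜 T hT (fun i => (n i : ℤ)) := by
  simp only [IsMixingAlong, zpow_natCast]
  intro f
  refine Lp.induction (by norm_num) _ ?_ ?_ ?_ f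
  · intro c A hA hμA g
    refine Lp.induction (by norm_num) _ ?_ ?_ ?_ g
    · intro d B hB hμB
      simp only [Lp.simpleFunc.coe_indicatorConst, koopman_pow_apply,
        Lp.indicatorConstLp_compMeasurePreserving, inner_constProjection]
      rw [← indicatorConstLp_univ]
      simp only [L2.inner_indicatorConstLp_indicatorConstLp, Set.univ_inter, Set.inter_univ]
      have hlim := ((RCLike.continuous_ofReal (K := 𝕜)).tendsto _).comp (hn A B hA hB)
      have := hlim.mul_const (inner 𝕜 d c)
      convert this using 2
      · rw [Function.comp_apply, Set.inter_comm, RCLike.real_smul_eq_coe_mul]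
      · simp only [RCLike.real_smul_eq_coe_mul, RCLike.inner_apply, map_one, map_mul]
        ring
    · intro g g' hg hg' _ h1 h2
      simp only [inner_add_left]
      exact h1.add h2
    · have hlip : ∀ i, LipschitzWith ‖(Lp.simpleFunc.indicatorConst 2 hA hμA.ne c : Lp 𝕜 2 μ)‖₊
          (fun g : Lp 𝕜 2 μ => inner 𝕜 g
            ((koopman 𝕜 T hT ^ n i) (Lp.simpleFunc.indicatorConst 2 hA hμA.ne c))) := by
        intro i
        refine LipschitzWith.of_dist_le_mul fun g g' => ?_
        rw [dist_eq_norm, dist_eq_norm, ← inner_sub_left, mul_comm, coe_nnnorm]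
        refine (norm_inner_le_norm _ _).trans (le_of_eq ?_)
        rw [LinearIsometryEquiv.norm_map]
      exact (LipschitzWith.uniformEquicontinuous _ _ hlip).equicontinuous.isClosed_setOfPred_tendsto
        (continuous_id.inner continuous_const)
  · intro f f' hf hf' _ h1 h2 g
    simp only [map_add, inner_add_right]
    exact (h1 g).add (h2 g)
  · have hset : {f : Lp 𝕜 2 μ | ∀ g : Lp 𝕜 2 μ,
        Tendsto (fun i => inner 𝕜 g ((koopman 𝕜 T hT ^ n i) f)) atTop
          (𝓝 (inner 𝕜 g (constProjection 𝕜 μ f)))}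
        = ⋂ g : Lp 𝕜 2 μ, {f : Lp 𝕜 2 μ |
        Tendsto (fun i => inner 𝕜 g ((koopman 𝕜 T hT ^ n i) f)) atTop
          (𝓝 (inner 𝕜 g (constProjection 𝕜 μ f)))} := by
      ext f; simp
    rw [hset]
    refine isClosed_iInter fun g => ?_
    have hlip : ∀ i, LipschitzWith ‖g‖₊
        (fun f : Lp 𝕜 2 μ => inner 𝕜 g ((koopman 𝕜 T hT ^ n i) f)) := by
      intro i
      refine LipschitzWith.of_dist_le_mul fun f f' => ?_
      rw [dist_eq_norm, dist_eq_norm, ← inner_sub_right, ← map_sub, coe_nnnorm]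
      refine (norm_inner_le_norm _ _).trans (le_of_eq ?_)
      rw [LinearIsometryEquiv.norm_map]
    exact (LipschitzWith.uniformEquicontinuous _ _ hlip).equicontinuous.isClosed_setOfPred_tendsto
      (continuous_const.inner (constProjection 𝕜 μ).continuous)

/-- The operator of a negative time is the adjoint of that of the positive time, and the projection
is self-adjoint. -/
theorem isMixingAlong_of_natAbs (hT : MeasurePreserving T μ μ) {n : ℕ → ℤ}
    (hn : IsMixingAlong 𝕜 T hT (fun i => ((n i).natAbs : ℤ))) : IsMixingAlong 𝕜 T hT n := by
  intro f g
  have h1 := hn f g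
  have h2 : Tendsto (fun i => inner 𝕜 g ((koopman 𝕜 T hT ^ (-((n i).natAbs : ℤ))) f)) atTop
      (𝓝 (inner 𝕜 g (constProjection 𝕜 μ f))) := by
    rw [inner_constProjection_symm]
    refine ((RCLike.continuous_conj.tendsto _).comp (hn g f)).congr fun i => ?_
    rw [Function.comp_apply, inner_conj_symm,
      ← LinearIsometryEquiv.inner_map_map (koopman 𝕜 T hT ^ ((n i).natAbs : ℤ)) g,
      ← Function.comp_apply (f := ⇑(koopman 𝕜 T hT ^ ((n i).natAbs : ℤ))) (x := f),
      ← LinearIsometryEquiv.coe_mul, ← zpow_add, add_neg_cancel, zpow_zero]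
    rfl
  rw [Metric.tendsto_nhds] at h1 h2 ⊢
  intro ε hε
  filter_upwards [h1 ε hε, h2 ε hε] with i hi1 hi2
  rcases Int.natAbs_eq (n i) with h | h
  · rwa [← h] at hi1
  · rwa [← h] at hi2

/-- A large time outside `mixingTimes` lies in an interval around half a height, and then between
that height and the previous one. -/
theorem exists_mem_halfInterval_of_notMem_mixingTimes {h₁ : ℕ} {r' : ℕ → ℕ}
    (hr : ∀ j, 1 ≤ r' j) (hr_top : Tendsto r' atTop atTop) :
    ∃ N, ∀ m ≥ N, m ∉ mixingTimes h₁ r' → ∃ j, dsHeight h₁ r' j ≤ m ∧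
      m < dsHeight h₁ r' (j + 1) ∧ (m : ℝ) ∈ halfInterval h₁ r' j := by
  obtain ⟨t, ht⟩ := eventually_atTop.1 (hr_top.eventually_ge_atTop 2)
  refine ⟨2 * levelCount h₁ r' t, fun m hm hmM => ?_⟩
  obtain ⟨j, hj⟩ : ∃ j, (m : ℝ) ∈ halfInterval h₁ r' j := by
    by_contra hne
    exact hmM fun hmem => hne (Set.mem_iUnion.1 hmem)
  have hlow : (dsHeight h₁ r' (j + 1) : ℝ) ≤ 2 * m + 2 * dsHeight h₁ r' j := by
    linarith [hj.1]
  have hupp : 2 * (m : ℝ) ≤ dsHeight h₁ r' (j + 1) + 2 * dsHeight h₁ r' j := by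
    linarith [hj.2]
  have hlow' : dsHeight h₁ r' (j + 1) ≤ 2 * m + 2 * dsHeight h₁ r' j := by exact_mod_cast hlow
  have hupp' : 2 * m ≤ dsHeight h₁ r' (j + 1) + 2 * dsHeight h₁ r' j := by exact_mod_cast hupp
  have hmono := (strictMono_levelCount (h₁ := h₁) hr).monotone
  have htj : t ≤ j := by
    by_contra hlt
    have h1 := hmono (show j + 1 ≤ t by omega)
    have h2 := hmono (show j ≤ t by omega)
    simp only [levelCount] at h1 h2 hm
    omega
  have hgrow : 4 * levelCount h₁ r' j ≤ levelCount h₁ r' (j + 1) := by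
    rw [levelCount_succ hr, columnStart_eq]
    have : 4 * levelCount h₁ r' j ≤ 2 * r' j * levelCount h₁ r' j :=
      Nat.mul_le_mul_right _ (by have := ht j htj; omega)
    omega
  simp only [levelCount] at hgrow
  exact ⟨j, by omega, by omega, hj⟩

theorem isMixingAlong_of_mem_mixingTimes (hT : MeasurePreserving T μ μ) {h₁ : ℕ} {r' : ℕ → ℕ}
    (hr : ∀ j, 1 ≤ r' j) (hr_top : Tendsto r' atTop atTop)
    (hr_adams : Tendsto (fun j => ((2 * r' j : ℕ) : ℝ) ^ 2 / (dsHeight h₁ r' j : ℝ)) atTop (𝓝 0))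
    (hDS : IsDoubleStaircase μ T h₁ r') {m : ℕ → ℕ} (hm : Tendsto m atTop atTop)
    (hmM : ∀ᶠ i in atTop, m i ∈ mixingTimes h₁ r') :
    IsMixingAlong 𝕜 T hT (fun i => (m i : ℤ)) := by
  obtain ⟨E, C, h⟩ := hDS
  refine isMixingAlong_of_tendsto_measureReal hT fun A B hA hB =>
    h.tendsto_measureReal_of_levelFun hT hr (fun j f g hf hg hf0 => ?_) hA hB
  rw [Metric.tendsto_nhds]
  intro ε hε
  obtain ⟨N, hN⟩ := h.exists_abs_integral_le_of_mem_mixingTimes hT hr hr_top hr_adams hf hg hf0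
    (half_pos hε)
  filter_upwards [hmM, hm.eventually_ge_atTop N] with i hi hiN
  rw [dist_zero_right, Real.norm_eq_abs]
  exact (hN (m i) hiN hi).trans_lt (by linarith)

theorem isMixingAlong_of_eventually_notMem_halfInterval (hT : MeasurePreserving T μ μ) {h₁ : ℕ}
    {r' : ℕ → ℕ} (hr : ∀ j, 1 ≤ r' j) (hr_top : Tendsto r' atTop atTop)
    (hr_adams : Tendsto (fun j => ((2 * r' j : ℕ) : ℝ) ^ 2 / (dsHeight h₁ r' j : ℝ)) atTop (𝓝 0))
    (hDS : IsDoubleStaircase μ T h₁ r') {n : ℕ → ℤ} (hn : Tendsto (fun i => |n i|) atTop atTop)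
    (hnP : ∀ᶠ i in atTop, ¬ ∃ j, (dsHeight h₁ r' j : ℤ) ≤ |n i| ∧
      |n i| < (dsHeight h₁ r' (j + 1) : ℤ) ∧ ((|n i| : ℤ) : ℝ) ∈ halfInterval h₁ r' j) :
    IsMixingAlong 𝕜 T hT n := by
  obtain ⟨N, hN⟩ := exists_mem_halfInterval_of_notMem_mixingTimes (h₁ := h₁) hr hr_top
  have hnat : Tendsto (fun i => (n i).natAbs) atTop atTop := by
    refine tendsto_atTop.2 fun b => ?_
    filter_upwards [hn.eventually_ge_atTop (b : ℤ)] with i hi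
    rw [Int.abs_eq_natAbs] at hi
    exact_mod_cast hi
  refine isMixingAlong_of_natAbs hT
    (isMixingAlong_of_mem_mixingTimes hT hr hr_top hr_adams hDS hnat ?_)
  filter_upwards [hnP, hnat.eventually_ge_atTop N] with i hi hiN
  by_contra hmem
  obtain ⟨j, hj1, hj2, hj3⟩ := hN _ hiN hmem
  rw [Int.abs_eq_natAbs] at hi
  exact hi ⟨j, by exact_mod_cast hj1, by exact_mod_cast hj2, by rwa [Int.cast_natCast]⟩

end WeakConvergence

theorem lemma1 {X : Type*} [MeasurableSpace X] (μ : Measure X) [IsProbabilityMeasure μ]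
    (𝕜 : Type*) [RCLike 𝕜]
    (T : X ≃ᵐ X) (hT : MeasurePreserving T μ μ)
    (h₁ : ℕ) (r' : ℕ → ℕ) (hr_pos : ∀ j, 1 ≤ r' j)
    (hr_top : Tendsto r' atTop atTop)
    (hr_adams : Tendsto (fun j => ((2 * r' j : ℕ) : ℝ) ^ 2 / (dsHeight h₁ r' j : ℝ)) atTop (𝓝 0))
    (hDS : IsDoubleStaircase μ T h₁ r') :
    -- `M` is a mixing set
    (∀ m : ℕ → ℕ, Tendsto m atTop atTop → (∀ i, m i ∈ mixingTimes h₁ r') →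
      IsMixingAlong 𝕜 T hT (fun i => (m i : ℤ))) ∧
    -- a sequence without mixing subsequences is eventually near half the heights
    (∀ n : ℕ → ℤ, Tendsto (fun i => |n i|) atTop atTop →
      (∀ φ : ℕ → ℕ, StrictMono φ → ¬ IsMixingAlong 𝕜 T hT (fun i => n (φ i))) →
      ∀ᶠ i in atTop, ∃ j, (dsHeight h₁ r' j : ℤ) ≤ |n i| ∧ |n i| < (dsHeight h₁ r' (j + 1) : ℤ) ∧
        ((|n i| : ℤ) : ℝ) ∈ halfInterval h₁ r' j) ∧
    -- a sequence that is not mixing is infinitely often near half the heights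
    (∀ n : ℕ → ℤ, Tendsto (fun i => |n i|) atTop atTop →
      ¬ IsMixingAlong 𝕜 T hT n →
      ∃ᶠ i in atTop, ∃ j, (dsHeight h₁ r' j : ℤ) ≤ |n i| ∧ |n i| < (dsHeight h₁ r' (j + 1) : ℤ) ∧
        ((|n i| : ℤ) : ℝ) ∈ halfInterval h₁ r' j) := by

  refine ⟨fun m hm hmM => isMixingAlong_of_mem_mixingTimes hT hr_pos hr_top hr_adams hDS hm
    (Eventually.of_forall hmM), fun n hn hno => ?_, fun n hn hno => ?_⟩
  · by_contra hev
    obtain ⟨φ, hφ, hφP⟩ := extraction_of_frequently_atTop (not_eventually.1 hev)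
    exact hno φ hφ (isMixingAlong_of_eventually_notMem_halfInterval hT hr_pos hr_top hr_adams hDS
      (hn.comp hφ.tendsto_atTop) (Eventually.of_forall hφP))
  · by_contra hfr
    exact hno (isMixingAlong_of_eventually_notMem_halfInterval hT hr_pos hr_top hr_adams hDS hn
      (not_frequently.1 hfr))
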